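/- A \emph{graph} is a finite one-dimensional CW complex $G$ without isolated vertices (loops and multiple edges are allowed); $V(G)$ and $E(G)$ denote its sets of vertices and edges. A \emph{subgraph} of $G$ is an edge-induced subgraph, i.e. it consists of a set of edges of $G$ together with their endpoints. A \emph{labelled graph} is a pair $(G,l)$ of a graph $G$ and a subset $l\subseteq V(G)$, whose elements are called labelled vertices. The rank of a connected graph is the rank of its (free) fundamental group. For a labelled graph $(G,l)$, let $X(G,l)$ be the poset, ordered by inclusion, of all proper subgraphs $H\subsetneq G$ such that at least one connected component of $H$ has non-trivial fundamental group or contains at least two labelled vertices. Topological statements about $X(G,l)$ refer to the geometric realization of its order complex. An edge $e$ of a connected labelled graph $(G,l)$ is called \emph{$l$-separating} if (1) removing a point of the interior of $e$ disconnects $G$ (in particular, this holds if $e$ has an endpoint of valence one); (2) one of the connected components of $G\setminus e^\circ$ (the interior of $e$ is removed, all vertices are kept) contains all labelled vertices; (3) the subgraph of $G$ with edge set $E(G)\setminus\{e\}$ belongs to $X(G,l)$. A point is regarded as a (trivial) wedge of $d$-spheres for every $d\in\mathbb Z$; for $d<0$, the only other wedge of $d$-spheres is the empty space, and the empty space is not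 contractible. \textbf{Lemma.} Let $(G,l)$ be a connected labelled graph of rank $n$ with $k=|l|$ labelled vertices, and let \[ d(G,l)=\begin{cases} n+k-3 & \text{if } k\ge 1,\\ n-2 & \text{if } k=0.\end{cases} \] Then $X(G,l)$ is homotopy equivalent to a wedge of $d(G,l)$-spheres. Moreover, $X(G,l)$ is contractible if and only if $G$ has an $l$-separating edge. -/

import Mathlib

open CategoryTheory

/-! ### Finite graphs as one-dimensional CW complexes -/

/-- A graph in the topological sense, that is, a one-dimensional CW complex: `V` is the set of
vertices, `E` is the set of edges, and each edge `e` is a closed interval attached to the vertices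
along its two ends `src e` and `tgt e`. Loops and multiple edges are allowed. The order of the two
ends only records a parametrisation of the edge. -/
structure CWGraph (V : Type*) (E : Type*) where
  /-- the vertex to which the first end of an edge is attached -/
  src : E → V
  /-- the vertex to which the second end of an edge is attached -/
  tgt : E → V

namespace CWGraph

variable {V : Type*} {E : Type*}

/-- Two vertices are joined if they lie in the same connected component. -/
def Joined (G : CWGraph V E) : V → V → Prop :=
  Relation.EqvGen fun u v => ∃ e, G.src e = u ∧ G.tgt e = v

/-- The set of vertices of the connected component of `v`. -/
def component (G : CWGraph V E) (v : V) : Set V := {w | G.Joined v w}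

/-- A graph is connected if it has exactly one connected component. -/
def IsConnected (G : CWGraph V E) : Prop :=
  Nonempty V ∧ ∀ u v, G.Joined u v

/-- The set of vertices which are an endpoint of some edge in `S`. -/
def verts (G : CWGraph V E) (S : Set E) : Set V :=
  {v | ∃ e ∈ S, G.src e = v ∨ G.tgt e = v}

/-- A graph has no isolated vertices if every vertex is an endpoint of some edge. -/
def NoIsolatedVertices (G : CWGraph V E) : Prop := ∀ v, v ∈ G.verts Set.univ

/-- The subgraph induced by a set `S` of edges: its edges are those in `S`, its vertices are their
endpoints. -/
def edgeInduced (G : CWGraph V E) (S : Set E) : CWGraph (G.verts S) S where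
  src e := ⟨G.src e, e, e.2, Or.inl rfl⟩
  tgt e := ⟨G.tgt e, e, e.2, Or.inr rfl⟩

/-- The graph obtained by removing the interior of the edge `e` and keeping all the vertices. -/
def removeInterior (G : CWGraph V E) (e : E) : CWGraph V {f : E // f ≠ e} where
  src f := G.src f
  tgt f := G.tgt f

/-- A copy of the vertex type, on which `G` induces a quiver: there is one arrow for every edge,
from its source to its target. -/
def Vertex (_ : CWGraph V E) : Type _ := V

instance (G : CWGraph V E) : Quiver G.Vertex where
  Hom a b := {e : E // G.src e = a ∧ G.tgt e = b}

/-- The fundamental group of `G` at the vertex `v`, as the edge-path group: its elements are the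
closed edge paths at `v`, in which edges are traversed in either direction, modulo insertion and
deletion of backtracks. This is the vertex group at `v` of the free groupoid on the edges. -/
abbrev FundGroup (G : CWGraph V E) (v : V) : Type _ :=
  (Quiver.FreeGroupoid.of G.Vertex).obj v ⟶ (Quiver.FreeGroupoid.of G.Vertex).obj v

/-- A connected graph `G` has rank `n` if its fundamental group (at some, hence any, vertex) is
free of rank `n`. -/
def HasRank (G : CWGraph V E) (n : ℕ) : Prop :=
  ∃ v : V, Nonempty (G.FundGroup v ≃* FreeGroup (Fin n))

/-- Some connected component of `G` has non-trivial fundamental group or contains at least two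
vertices of `l`. Here the component is that of the vertex `v`. -/
def HasBigComponent (G : CWGraph V E) (l : Set V) : Prop :=
  ∃ v : V, Nontrivial (G.FundGroup v) ∨ (l ∩ G.component v).Nontrivial

/-- The poset `X(G, l)` of proper subgraphs of `G` which have a connected component that has
non-trivial fundamental group or contains at least two labelled vertices. A subgraph is given by
its set of edges, so the order is inclusion. -/
def nonTrees (G : CWGraph V E) (l : Set V) : Set (Set E) :=
  {S | S ≠ Set.univ ∧ (G.edgeInduced S).HasBigComponent (Subtype.val ⁻¹' l)}

/-- In a connected graph, an edge is separating if removing a point of its interior disconnects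
the graph. Up to homotopy, this removes the interior of the edge and keeps all vertices. -/
def IsSeparating (G : CWGraph V E) (e : E) : Prop :=
  ¬ (G.removeInterior e).IsConnected

/-- An edge `e` is `l`-separating if it is separating, one component of `G` without the interior
of `e` contains all labelled vertices, and the subgraph on all edges but `e` lies in `X(G, l)`. -/
structure IsLSeparating (G : CWGraph V E) (l : Set V) (e : E) : Prop where
  separating : G.IsSeparating e
  labels_on_one_side : ∃ v, l ⊆ (G.removeInterior e).component v
  compl_mem : {e}ᶜ ∈ G.nonTrees l

end CWGraph

/-! ### Order complexes and wedges of spheres -/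

/-- The geometric realisation of the order complex of a finite poset `P`: in barycentric
coordinates, the points are the families of non-negative reals with sum one whose support
is a chain. -/
def OrderComplex (P : Type*) [PartialOrder P] [Finite P] : Type _ :=
  {t : P → ℝ // (∀ p, 0 ≤ t p) ∧ ∑ᶠ p, t p = 1 ∧ IsChain (· ≤ ·) {p | t p ≠ 0}}

instance (P : Type*) [PartialOrder P] [Finite P] : TopologicalSpace (OrderComplex P) :=
  instTopologicalSpaceSubtype

/-- The `d`-dimensional sphere. -/
abbrev StdSphere (d : ℕ) : Type := Metric.sphere (0 : EuclideanSpace ℝ (Fin (d + 1))) 1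

/-- The base point of the `d`-dimensional sphere. -/
noncomputable def StdSphere.base (d : ℕ) : StdSphere d :=
  ⟨EuclideanSpace.single 0 1, by simp⟩

/-- The wedge of `m` spheres of dimension `d`: the disjoint union of a point and `m` spheres,
where the base points of all the spheres are identified with the point. For `m = 0` it is a
point. -/
def WedgeOfSpheres (m d : ℕ) : Type :=
  Quot fun a b : Unit ⊕ (Σ _ : Fin m, StdSphere d) =>
    ∃ i, a = Sum.inl () ∧ b = Sum.inr ⟨i, StdSphere.base d⟩

instance (m d : ℕ) : TopologicalSpace (WedgeOfSpheres m d) :=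
  instTopologicalSpaceQuot

open ContinuousMap in
/-- The space `X` is homotopy equivalent to a (finite, possibly trivial) wedge of `d`-spheres.
By convention, a point is a wedge of `d`-spheres for every integer `d`, and for `d < 0` the only
other wedge of `d`-spheres is the empty space. -/
def IsHomotopyWedge (d : ℤ) (X : Type*) [TopologicalSpace X] : Prop :=
  if d < 0 then IsEmpty X ∨ ContractibleSpace X
  else ∃ m : ℕ, Nonempty (X ≃ₕ WedgeOfSpheres m d.toNat)

/-! Pass from a subgraph to the complementary set `T` of edges. Every edge has a class in the
relative cohomology of `(G, l)` modulo two, the quotient of all edge cochains by the coboundaries of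
functions vanishing on `l`. All components of a subgraph are trees with at most one label exactly
when every cochain on it is the coboundary of a function vanishing on the labels, that is, when the
classes of the edges in `T` span. Hence `X(G, l)` is, with reversed order, the poset of nonempty
sets of edges whose classes do not span (`CWGraph.mem_nonTrees_iff`). Since absolute cohomology is
`Hom(π₁, ℤ/2)`, the relative one has dimension `r = n + k - 1` for `k ≥ 1` and `r = n` for `k = 0`,
so that `d(G, l) = r - 2`.

If `r > 0` and the class of `e` is zero, then `T ≤ T ∪ {e} ≥ {e}` contracts the poset; these `e` are
precisely the `l`-separating edges (`CWGraph.isLSeparating_iff`). In the remaining cases with `r ≤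
1` the poset is empty. If `r ≥ 2` and no class is zero, sending `T` to the set of all edges with
class in the span of `T` retracts the poset onto the proper part of a geometric lattice of rank `r`:
the lattice of subspaces spanned by edge classes.

The proper part of a geometric lattice is treated by induction on the rank. Fix an atom `a`. Without
the coatoms that are not above `a`, the poset is contracted by `x ≤ x ⊔ a ≥ a`; each of these
coatoms then adds a cone over its own lower interval. In combinatorial form: after deleting a
nonempty set of top-dimensional simplices the order complex is collapsible
(`IsGeometricRank.exists_collapsible_sdiff`). Shrinking the contractible rest to a point turns the
deleted simplices into spheres (`Realization.nonempty_homotopyEquiv_wedgeOfSpheres`).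

A wedge of at least one sphere is not contractible, because each sphere is a retract of it and
spheres are not contractible (`not_contractibleSpace_sphere`, by a volume argument). -/

/-! ### Simplicial complexes and collapses -/

section Complexes

open Finset

variable {V : Type*} [Fintype V]

/-- The set of vertices at which a family of barycentric coordinates does not vanish. -/
noncomputable def coordSupport (t : V → ℝ) : Finset V := by
  classical exact univ.filter fun v => t v ≠ 0

@[simp]
theorem mem_coordSupport {t : V → ℝ} {v : V} : v ∈ coordSupport t ↔ t v ≠ 0 := by
  simp [coordSupport]

/-- The geometric realisation of a family `K` of finite sets of vertices, in barycentric
coordinates. If `K` is closed under passing to subsets, this is the realisation of the simplicial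
complex whose simplices are the nonempty members of `K`. -/
def Realization (K : Set (Finset V)) : Type _ :=
  {t : V → ℝ // (∀ v, 0 ≤ t v) ∧ ∑ v, t v = 1 ∧ coordSupport t ∈ K}

instance (K : Set (Finset V)) : TopologicalSpace (Realization K) :=
  instTopologicalSpaceSubtype

namespace Realization

variable {K L : Set (Finset V)}

theorem continuous_val : Continuous (Subtype.val : Realization K → V → ℝ) :=
  continuous_subtype_val

theorem continuous_coord (v : V) : Continuous fun t : Realization K => t.1 v :=
  (continuous_apply v).comp continuous_val

theorem coordSupport_nonempty (t : Realization K) : (coordSupport t.1).Nonempty := by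
  by_contra h
  rw [not_nonempty_iff_eq_empty] at h
  have h0 : ∀ v, t.1 v = 0 := fun v => by
    by_contra hv
    have : v ∈ coordSupport t.1 := mem_coordSupport.2 hv
    simp [h] at this
  have := t.2.2.1
  simp [h0] at this

/-- The inclusion of the realisation of a subcomplex. -/
def incl (h : L ⊆ K) : C(Realization L, Realization K) where
  toFun t := ⟨t.1, t.2.1, t.2.2.1, h t.2.2.2⟩
  continuous_toFun := continuous_val.subtype_mk _

theorem isEmpty_of_subset_singleton_empty (h : K ⊆ {∅}) : IsEmpty (Realization K) := by
  refine ⟨fun t => ?_⟩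
  have := h t.2.2.2
  exact t.coordSupport_nonempty.ne_empty this

end Realization

/-- The faces in `K` which do not contain `σ`. -/
def removeFaces (K : Set (Finset V)) (σ : Finset V) : Set (Finset V) := {τ ∈ K | ¬ σ ⊆ τ}

omit [Fintype V] in
theorem IsLowerSet.removeFaces {K : Set (Finset V)} (hK : IsLowerSet K) (σ : Finset V) :
    IsLowerSet (removeFaces K σ) :=
  fun _ _ hle h => ⟨hK hle h.1, fun hσ => h.2 (hσ.trans hle)⟩

variable [DecidableEq V]

/-- The link of the face `σ` of `K` is a cone with apex `v`. -/
structure IsDominated (K : Set (Finset V)) (σ : Finset V) (v : V) : Prop where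
  notMem : v ∉ σ
  insert_mem : ∀ τ ∈ K, σ ⊆ τ → insert v τ ∈ K

/-- `L` is obtained from `K` by removing, one after the other, all faces containing a given
nonempty face whose link is a cone. -/
inductive CollapsesTo : Set (Finset V) → Set (Finset V) → Prop
  | refl (K) : CollapsesTo K K
  | step (K L σ v) : IsDominated K σ v → σ.Nonempty → CollapsesTo (removeFaces K σ) L →
      CollapsesTo K L

/-- All of `K` can be removed by removing, one after the other, all faces containing a given
(possibly empty) face whose link is a cone. -/
inductive Collapsible : Set (Finset V) → Prop
  | empty : Collapsible ∅
  | step (K σ v) : IsDominated K σ v → Collapsible (removeFaces K σ) → Collapsible K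

omit [Fintype V] in
theorem CollapsesTo.collapsible {K L : Set (Finset V)} (h : CollapsesTo K L)
    (hL : Collapsible L) : Collapsible K := by
  induction h with
  | refl K => exact hL
  | step K L σ v hd _ _ ih => exact .step K σ v hd (ih hL)

omit [Fintype V] in
-- The complex is a cone with apex `v`, and every face contains `∅`, so a single step removes
-- everything.
theorem collapsible_of_isDominated_empty {K : Set (Finset V)} {v : V} (h : IsDominated K ∅ v) :
    Collapsible K := by
  refine .step K ∅ v h ?_
  have : removeFaces K ∅ = ∅ := by ext; simp [removeFaces]
  rw [this]
  exact .empty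

omit [Fintype V] in
/-- Faces containing a vertex `x` with collapsible link can be removed. -/
theorem Collapsible.of_link {N : Set (Finset V)} (hN : Collapsible N) {x : V}
    (hx : ∀ τ ∈ N, x ∉ τ) {K : Set (Finset V)}
    (hlink : ∀ τ, x ∈ τ → (τ ∈ K ↔ τ.erase x ∈ N))
    (hdel : Collapsible {τ ∈ K | x ∉ τ}) : Collapsible K := by
  induction hN generalizing K with
  | empty =>
    convert hdel using 1
    ext τ
    simp only [Set.mem_ofPred_eq, iff_self_and]
    intro hτ hxτ
    simpa using (hlink τ hxτ).1 hτ
  | step N σ v hd hN ih =>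
    by_cases hσN : ∃ τ ∈ N, σ ⊆ τ
    -- A face of `N` above `σ` is what forces `x ≠ v` and `x ∉ σ`.
    · obtain ⟨τ₀, hτ₀, hστ₀⟩ := hσN
      have hxv : x ≠ v := by
        rintro rfl
        exact hx _ (hd.insert_mem τ₀ hτ₀ hστ₀) (mem_insert_self _ _)
      have hxσ : x ∉ σ := fun h => hx τ₀ hτ₀ (hστ₀ h)
      -- The collapse of the link at `σ` lifts to a collapse of `K` at `insert x σ` with the same
      -- apex.
      refine .step K (insert x σ) v ⟨?_, fun τ hτ hσ => ?_⟩ (ih (fun τ hτ => hx τ hτ.1) ?_ ?_)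
      · simp [hxv.symm, hd.notMem]
      · have hxτ : x ∈ τ := hσ (mem_insert_self _ _)
        rw [hlink _ (mem_insert_of_mem hxτ), erase_insert_of_ne hxv.symm]
        refine hd.insert_mem _ ((hlink τ hxτ).1 hτ) fun w hw => mem_erase.2 ⟨?_, ?_⟩
        · rintro rfl; exact hxσ hw
        · exact hσ (mem_insert_of_mem hw)
      · intro τ hxτ
        simp only [removeFaces, Set.mem_ofPred_eq, hlink τ hxτ, and_congr_right_iff, not_iff_not]
        intro _
        constructor
        · intro h w hw
          refine mem_erase.2 ⟨?_, h (mem_insert_of_mem hw)⟩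
          rintro rfl; exact hxσ hw
        · intro h
          exact insert_subset hxτ (h.trans (erase_subset _ _))
      · convert hdel using 1
        ext τ
        simp only [removeFaces, Set.mem_ofPred_eq]
        constructor
        · rintro ⟨⟨h1, _⟩, h2⟩
          exact ⟨h1, h2⟩
        · rintro ⟨h1, h2⟩
          exact ⟨⟨h1, fun h => h2 (h (mem_insert_self _ _))⟩, h2⟩
    -- Here the step of the link removes nothing, so there is nothing to lift.
    · have : removeFaces N σ = N := by
        ext τ
        simp only [removeFaces, Set.mem_ofPred_eq, and_iff_left_iff_imp]
        exact fun hτ hσ => hσN ⟨τ, hτ, hσ⟩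
      rw [this] at ih
      exact ih hx hlink hdel

/-! The effect of collapses on realisations. -/

namespace Realization

variable {K : Set (Finset V)}

/-- Pushes `t` along the direction from the barycentre of `σ` to `v`, up to the fraction `s` of
the way until a coordinate in `σ` vanishes. -/
noncomputable def push (σ : Finset V) (hσ : σ.Nonempty) (v : V) (s : ℝ) (t : V → ℝ) : V → ℝ :=
  fun w => t w - s * σ.inf' hσ t * (if w ∈ σ then 1 else 0)
    + s * σ.inf' hσ t * #σ * (if w = v then 1 else 0)

omit [Fintype V] in
theorem continuous_push (σ : Finset V) (hσ : σ.Nonempty) (v : V) :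
    Continuous fun p : ℝ × (V → ℝ) => push σ hσ v p.1 p.2 := by
  have hm : Continuous fun p : ℝ × (V → ℝ) => σ.inf' hσ p.2 :=
    Continuous.finset_inf'_apply hσ fun i _ => (continuous_apply i).comp continuous_snd
  refine continuous_pi fun w => ?_
  unfold push
  fun_prop

/-- The minimum over `σ` vanishes as soon as one coordinate in `σ` does. Hence the push is
stationary on the faces that survive. -/
theorem push_eq_self {σ : Finset V} (hσ : σ.Nonempty) (v : V) (s : ℝ) {t : V → ℝ}
    (ht : ∀ w, 0 ≤ t w) (h : ¬ σ ⊆ coordSupport t) : push σ hσ v s t = t := by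
  obtain ⟨w, hw, hw0⟩ := not_subset.1 h
  have hw0' : t w = 0 := by simpa using hw0
  have : σ.inf' hσ t = 0 :=
    le_antisymm (hw0' ▸ inf'_le t hw) (le_inf' _ _ fun w _ => ht w)
  funext w
  simp [push, this]

omit [Fintype V] in
theorem push_zero {σ : Finset V} (hσ : σ.Nonempty) (v : V) (t : V → ℝ) :
    push σ hσ v 0 t = t := by
  funext w
  simp [push]

/-- The total `#σ` times the amount taken from each vertex of `σ` is given to `v`, so the sum is
preserved. The support grows at most by `v`, which domination permits. -/
theorem push_mem {σ : Finset V} {v : V} (hK : IsLowerSet K) (hd : IsDominated K σ v)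
    (hσ : σ.Nonempty) {s : ℝ} (hs0 : 0 ≤ s) (hs1 : s ≤ 1) (t : Realization K) :
    (∀ w, 0 ≤ push σ hσ v s t.1 w) ∧ ∑ w, push σ hσ v s t.1 w = 1 ∧
      coordSupport (push σ hσ v s t.1) ∈ K := by
  have hm0 : 0 ≤ σ.inf' hσ t.1 := le_inf' _ _ fun w _ => t.2.1 w
  refine ⟨fun w => ?_, ?_, ?_⟩
  · have h2 : 0 ≤ s * σ.inf' hσ t.1 * #σ * (if w = v then 1 else 0) := by
      split_ifs <;> positivity
    have h1 : 0 ≤ t.1 w - s * σ.inf' hσ t.1 * (if w ∈ σ then 1 else 0) := by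
      split_ifs with hw
      · have : σ.inf' hσ t.1 ≤ t.1 w := inf'_le _ hw
        nlinarith
      · simpa using t.2.1 w
    exact add_nonneg h1 h2
  · simp only [push, sum_add_distrib, sum_sub_distrib, ← mul_sum, t.2.2.1]
    simp
  · by_cases h : σ ⊆ coordSupport t.1
    · refine hK (fun w hw => ?_) (hd.insert_mem _ t.2.2.2 h)
      rw [mem_coordSupport] at hw
      by_contra hnot
      rw [mem_insert, not_or, mem_coordSupport, not_not] at hnot
      have hwσ : w ∉ σ := fun hwσ => mem_coordSupport.1 (h hwσ) hnot.2
      simp [push, hnot.1, hnot.2, hwσ] at hw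
    · rw [push_eq_self hσ v s t.2.1 h]
      exact t.2.2.2

/-- At time one a minimal coordinate in `σ` has become zero, and it is not refilled because `v ∉ σ`.
-/
theorem push_one_mem {σ : Finset V} {v : V} (hK : IsLowerSet K) (hd : IsDominated K σ v)
    (hσ : σ.Nonempty) (t : Realization K) :
    coordSupport (push σ hσ v 1 t.1) ∈ removeFaces K σ := by
  refine ⟨(push_mem hK hd hσ zero_le_one le_rfl t).2.2, fun h => ?_⟩
  obtain ⟨w, hw, hmin⟩ := exists_mem_eq_inf' hσ t.1
  have hwv : w ≠ v := by rintro rfl; exact hd.notMem hw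
  have := mem_coordSupport.1 (h hw)
  simp [push, hwv, hw, hmin] at this

/-- The push is a strong deformation retraction onto the surviving faces. -/
theorem nonempty_homotopyEquiv_removeFaces {σ : Finset V} {v : V} (hK : IsLowerSet K)
    (hd : IsDominated K σ v) (hσ : σ.Nonempty) :
    Nonempty (ContinuousMap.HomotopyEquiv (Realization K) (Realization (removeFaces K σ))) := by
  let f : C(Realization K, Realization (removeFaces K σ)) :=
    ⟨fun t => ⟨push σ hσ v 1 t.1, (push_mem hK hd hσ zero_le_one le_rfl t).1,
      (push_mem hK hd hσ zero_le_one le_rfl t).2.1, push_one_mem hK hd hσ t⟩,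
      ((continuous_push σ hσ v).comp (continuous_const.prodMk continuous_val)).subtype_mk _⟩
  let i : C(Realization (removeFaces K σ), Realization K) := incl fun _ h => h.1
  refine ⟨⟨f, i, ?_, ?_⟩⟩
  · refine ContinuousMap.Homotopic.symm ⟨⟨⟨fun p => ⟨push σ hσ v p.1 p.2.1,
      push_mem hK hd hσ p.1.2.1 p.1.2.2 p.2⟩, ?_⟩, ?_, ?_⟩⟩
    · exact ((continuous_push σ hσ v).comp ((continuous_subtype_val.comp continuous_fst).prodMk
        (continuous_val.comp continuous_snd))).subtype_mk _
    · exact fun t => Subtype.ext (push_zero hσ v t.1)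
    · exact fun t => rfl
  · have : f.comp i = ContinuousMap.id _ := by
      ext1 t
      exact Subtype.ext (push_eq_self hσ v 1 t.2.1 t.2.2.2.2)
    rw [this]

/-- The straight-line homotopy to the apex stays inside the cone. -/
theorem contractibleSpace_of_isDominated_empty {v : V} (hK : IsLowerSet K) (hne : K.Nonempty)
    (hd : IsDominated K ∅ v) : ContractibleSpace (Realization K) := by
  have hv : {v} ∈ K := by
    obtain ⟨τ, hτ⟩ := hne
    exact hK (by simp) (hd.insert_mem τ hτ (empty_subset _))
  have hsupp : coordSupport (Pi.single v 1 : V → ℝ) ⊆ {v} := by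
    intro w hw
    by_contra hwv
    simp at hw hwv
    exact hw (by simp [hwv])
  let p : Realization K := ⟨Pi.single v 1, fun w => by
    by_cases h : w = v
    · subst h; simp
    · simp [h], by simp, hK hsupp hv⟩
  rw [contractible_iff_id_nullhomotopic]
  refine ⟨p, ⟨⟨⟨fun q => ⟨fun w => (1 - q.1) * q.2.1 w + q.1 * p.1 w, fun w => ?_, ?_, ?_⟩, ?_⟩,
    ?_, ?_⟩⟩⟩
  · exact add_nonneg (mul_nonneg (sub_nonneg.2 q.1.2.2) (q.2.2.1 w))
      (mul_nonneg q.1.2.1 (p.2.1 w))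
  · rw [sum_add_distrib, ← mul_sum, ← mul_sum, q.2.2.2.1, p.2.2.1]
    ring
  · refine hK (fun w hw => ?_) (hd.insert_mem _ q.2.2.2.2 (empty_subset _))
    by_contra hnot
    rw [mem_insert, not_or, mem_coordSupport, not_not] at hnot
    rw [mem_coordSupport] at hw
    simp [hnot.2, p, hnot.1] at hw
  · refine Continuous.subtype_mk (continuous_pi fun w => ?_) _
    have h1 : Continuous fun q : unitInterval × Realization K => (q.1 : ℝ) :=
      continuous_subtype_val.comp continuous_fst
    have h2 : Continuous fun q : unitInterval × Realization K => q.2.1 w :=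
      (continuous_coord w).comp continuous_snd
    exact ((continuous_const.sub h1).mul h2).add (h1.mul continuous_const)
  · intro t
    refine Subtype.ext (funext fun w => ?_)
    simp
  · intro t
    refine Subtype.ext (funext fun w => ?_)
    simp

end Realization

theorem CollapsesTo.nonempty_homotopyEquiv {K L : Set (Finset V)} (h : CollapsesTo K L)
    (hK : IsLowerSet K) :
    Nonempty (ContinuousMap.HomotopyEquiv (Realization K) (Realization L)) := by
  induction h with
  | refl K => exact ⟨.refl _⟩
  | step K L σ v hd hσ _ ih =>
    obtain ⟨e⟩ := Realization.nonempty_homotopyEquiv_removeFaces hK hd hσ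
    obtain ⟨e'⟩ := ih (hK.removeFaces σ)
    exact ⟨e.trans e'⟩

/-- Steps with `σ ≠ ∅` are homotopy equivalences and keep the empty face; a step with `σ = ∅`
exhibits a cone. Nonemptiness of `K` excludes the family `∅`, which is collapsible but has empty
realisation. -/
theorem Collapsible.contractibleSpace {K : Set (Finset V)} (h : Collapsible K)
    (hK : IsLowerSet K) (hne : K.Nonempty) : ContractibleSpace (Realization K) := by
  induction h with
  | empty => exact absurd hne Set.not_nonempty_empty
  | step K σ v hd _ ih =>
    obtain rfl | hσ := σ.eq_empty_or_nonempty
    · exact Realization.contractibleSpace_of_isDominated_empty hK hne hd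
    · obtain ⟨e⟩ := Realization.nonempty_homotopyEquiv_removeFaces hK hd hσ
      obtain ⟨τ, hτ⟩ := hne
      have : ContractibleSpace (Realization (removeFaces K σ)) :=
        ih (hK.removeFaces σ) ⟨∅, hK (empty_subset τ) hτ, fun h => hσ.ne_empty (subset_empty.1 h)⟩
      exact e.contractibleSpace

omit [DecidableEq V] in
/-- Relabelling the vertices does not change the realisation. -/
theorem Realization.nonempty_homeomorph_of_injective {W : Type*} [Fintype W] {f : V → W}
    (hf : Function.Injective f) {K : Set (Finset V)} {L : Set (Finset W)}
    (hKL : ∀ σ : Finset V, σ.map ⟨f, hf⟩ ∈ L ↔ σ ∈ K)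
    (hL : ∀ τ ∈ L, ∀ w ∈ τ, w ∈ Set.range f) :
    Nonempty (Realization K ≃ₜ Realization L) := by
  classical
  have hsupp : ∀ t : W → ℝ, (∀ w, t w ≠ 0 → w ∈ Set.range f) →
      (coordSupport (t ∘ f)).map ⟨f, hf⟩ = coordSupport t := by
    intro t ht
    ext w
    simp only [mem_map, mem_coordSupport, Function.comp_apply, Function.Embedding.coeFn_mk]
    constructor
    · rintro ⟨v, hv, rfl⟩; exact hv
    · intro hw
      obtain ⟨v, rfl⟩ := ht w hw
      exact ⟨v, hw, rfl⟩
  have hsum : ∀ t : W → ℝ, (∀ w, t w ≠ 0 → w ∈ Set.range f) → ∑ v, t (f v) = ∑ w, t w := by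
    intro t ht
    refine (Finset.sum_map univ ⟨f, hf⟩ t).symm.trans ?_
    refine sum_subset (subset_univ _) fun w _ hw => ?_
    by_contra h
    obtain ⟨v, rfl⟩ := ht w h
    exact hw (mem_map.2 ⟨v, mem_univ _, rfl⟩)
  have hL' : ∀ (t : Realization L) (w : W), t.1 w ≠ 0 → w ∈ Set.range f := fun t w hw =>
    hL _ t.2.2.2 w (mem_coordSupport.2 hw)
  have hext : ∀ (t : V → ℝ) (w : W), Function.extend f t 0 w ≠ 0 → w ∈ Set.range f := by
    intro t w hw
    by_contra h
    exact hw (Function.extend_apply' _ _ _ h)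
  have hcomp : ∀ t : V → ℝ, Function.extend f t 0 ∘ f = t := fun t => by
    funext v
    exact hf.extend_apply _ _ _
  -- Coordinates are extended by zero in one direction and restricted along `f` in the other.
  refine ⟨⟨⟨fun t => ⟨Function.extend f t.1 0, fun w => ?_, ?_, ?_⟩,
    fun t => ⟨t.1 ∘ f, fun v => t.2.1 _, ?_, ?_⟩, fun t => Subtype.ext (hcomp t.1),
    fun t => Subtype.ext (funext fun w => ?_)⟩, ?_, ?_⟩⟩
  · by_cases hw : w ∈ Set.range f
    · obtain ⟨v, rfl⟩ := hw
      rw [hf.extend_apply]; exact t.2.1 v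
    · rw [Function.extend_apply' _ _ _ hw]; rfl
  · rw [← hsum _ (hext t.1)]
    simp only [hf.extend_apply]
    exact t.2.2.1
  · rw [← hsupp _ (hext t.1), hcomp, hKL]
    exact t.2.2.2
  · exact (hsum _ (hL' t)).trans t.2.2.1
  · rw [← hKL, hsupp _ (hL' t)]
    exact t.2.2.2
  · by_cases hw : w ∈ Set.range f
    · obtain ⟨v, rfl⟩ := hw
      exact hf.extend_apply _ _ _
    · simp only
      rw [Function.extend_apply' _ _ _ hw]
      by_contra h
      exact hw (hL' t w (Ne.symm h))
  · refine Continuous.subtype_mk (continuous_pi fun w => ?_) _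
    by_cases hw : w ∈ Set.range f
    · obtain ⟨v, rfl⟩ := hw
      simp only [hf.extend_apply]
      exact Realization.continuous_coord v
    · simp only [Function.extend_apply' _ _ _ hw]
      exact continuous_const
  · exact Continuous.subtype_mk
      (continuous_pi fun v => Realization.continuous_coord (f v)) _

end Complexes

/-! ### Order complexes of subsets of a poset -/

section Chains

open Finset

variable {V : Type*} [PartialOrder V]

/-- The finite chains of elements of `Q`. -/
def chainsIn (Q : Set V) : Set (Finset V) := {σ | (σ : Set V) ⊆ Q ∧ IsChain (· ≤ ·) (σ : Set V)}

theorem isLowerSet_chainsIn (Q : Set V) : IsLowerSet (chainsIn Q) := fun _ _ hle h =>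
  ⟨(coe_subset.2 hle).trans h.1, h.2.mono (coe_subset.2 hle)⟩

theorem chainsIn_nonempty (Q : Set V) : (chainsIn Q).Nonempty := ⟨∅, by simp [chainsIn]⟩

variable [DecidableEq V]

theorem insert_mem_chainsIn {Q : Set V} {v : V} {τ : Finset V} (hv : v ∈ Q) (hτ : τ ∈ chainsIn Q)
    (h : ∀ y ∈ τ, y ≤ v ∨ v ≤ y) : insert v τ ∈ chainsIn Q := by
  refine ⟨?_, ?_⟩
  · rw [coe_insert]
    exact Set.insert_subset hv hτ.1
  · rw [coe_insert]
    exact hτ.2.insert fun y hy _ => (h y hy).symm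

omit [DecidableEq V] in
theorem removeFaces_chainsIn (Q : Set V) (x : V) :
    removeFaces (chainsIn Q) {x} = chainsIn (Q \ {x}) := by
  ext τ
  simp only [removeFaces, chainsIn, Set.mem_ofPred_eq, singleton_subset_iff]
  constructor
  · rintro ⟨⟨h1, h2⟩, h3⟩
    exact ⟨fun y hy => ⟨h1 hy, fun h => h3 (by rw [← Set.mem_singleton_iff.1 h]; exact hy)⟩, h2⟩
  · rintro ⟨h1, h2⟩
    exact ⟨⟨fun y hy => (h1 hy).1, h2⟩, fun h => (h1 h).2 rfl⟩

theorem isDominated_chainsIn_empty {Q : Set V} {v : V} (hv : v ∈ Q)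
    (h : ∀ y ∈ Q, y ≤ v ∨ v ≤ y) : IsDominated (chainsIn Q) ∅ v :=
  ⟨notMem_empty _, fun _ hτ _ => insert_mem_chainsIn hv hτ fun y hy => h y (hτ.1 hy)⟩

/-- The order complex of a finite poset collapses to that of the closed elements of a closure
operator. -/
theorem collapsesTo_chainsIn_closed [Finite V] {Q : Set V} {c : V → V} (hc : ∀ x ∈ Q, c x ∈ Q)
    (hle : ∀ x ∈ Q, x ≤ c x) (hmono : ∀ x ∈ Q, ∀ y ∈ Q, x ≤ y → c x ≤ c y)
    (hidem : ∀ x ∈ Q, c (c x) = c x) :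
    CollapsesTo (chainsIn Q) (chainsIn {x ∈ Q | c x = x}) := by
  induction hn : {x ∈ Q | c x ≠ x}.ncard generalizing Q with
  | zero =>
    have h0 : {x ∈ Q | c x ≠ x} = ∅ := (Set.ncard_eq_zero (Set.toFinite _)).1 hn
    have : {x ∈ Q | c x = x} = Q := by
      ext x
      simp only [Set.mem_ofPred_eq, and_iff_left_iff_imp]
      intro hx
      by_contra hne
      exact Set.notMem_empty x (h0 ▸ (⟨hx, hne⟩ : x ∈ {x ∈ Q | c x ≠ x}))
    rw [this]
    exact .refl _
  | succ n ih =>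
    have hne : {x ∈ Q | c x ≠ x}.Nonempty := by
      rw [← Set.ncard_pos (Set.toFinite _), hn]; exact n.succ_pos
    obtain ⟨x, hx⟩ := (Set.toFinite {x ∈ Q | c x ≠ x}).exists_maximal hne
    have hxQ := hx.prop.1
    have hxc := hx.prop.2
    refine .step _ _ {x} (c x) ⟨by simpa using hxc, fun τ hτ hxτ => ?_⟩ (singleton_nonempty x) ?_
    · have hxτ' : x ∈ τ := singleton_subset_iff.1 hxτ
      refine insert_mem_chainsIn (hc x hxQ) hτ fun y hy => ?_
      rcases hτ.2.total hy hxτ' with h | h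
      · exact Or.inl (h.trans (hle x hxQ))
      · obtain rfl | hne := eq_or_ne x y
        · exact Or.inl (hle x hxQ)
        · have hyfix : c y = y := by
            by_contra hyc
            exact hne (le_antisymm h (hx.le_of_ge ⟨hτ.1 hy, hyc⟩ h))
          right
          rw [← hyfix]
          exact hmono x hxQ y (hτ.1 hy) h
    · rw [removeFaces_chainsIn]
      have hfix : {y ∈ Q | c y = y} = {y ∈ Q \ {x} | c y = y} := by
        ext y
        simp only [Set.mem_ofPred_eq, Set.mem_sdiff, Set.mem_singleton_iff]
        constructor
        · rintro ⟨h1, h2⟩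
          exact ⟨⟨h1, by rintro rfl; exact hxc h2⟩, h2⟩
        · rintro ⟨⟨h1, _⟩, h2⟩
          exact ⟨h1, h2⟩
      rw [hfix]
      refine ih (fun y hy => ⟨hc y hy.1, fun h => ?_⟩) (fun y hy => hle y hy.1)
        (fun y hy z hz => hmono y hy.1 z hz.1) (fun y hy => hidem y hy.1) ?_
      · rw [Set.mem_singleton_iff] at h
        exact hxc (h ▸ hidem y hy.1)
      · have : {y ∈ Q \ {x} | c y ≠ y} = {y ∈ Q | c y ≠ y} \ {x} := by
          ext y
          simp only [Set.mem_ofPred_eq, Set.mem_sdiff, Set.mem_singleton_iff]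
          tauto
        rw [this, Set.ncard_sdiff_singleton_of_mem hx.prop, hn]
        rfl

end Chains

/-! ### Collapsing a contractible subspace -/

section CollapseSubspace

open Set Topology unitInterval

variable {X Y : Type*} [TopologicalSpace X] [TopologicalSpace Y]

/-- If a contractible subspace `A` of a compact space `X` has a collar, given by a deformation `R`
and a height function `μ`, then `X` is homotopy equivalent to the quotient of `X` by `A`. -/
theorem nonempty_homotopyEquiv_of_collar [CompactSpace X] [T2Space Y] (A : Set X)
    [ContractibleSpace A] {R : I × X → X} (hR : Continuous R) {μ : X → ℝ} (hμ : Continuous μ)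
    (hμ0 : ∀ x, 0 ≤ μ x) (hμA : ∀ x ∈ A, μ x = 0) (hR0 : ∀ x, R (0, x) = x)
    (hRμ : ∀ (s : I) x, μ x ≤ s → R (s, x) ∈ A) {q : X → Y}
    (hq : Continuous q) (hqs : Function.Surjective q)
    (hqf : ∀ x y, q x = q y ↔ x = y ∨ (x ∈ A ∧ y ∈ A)) :
    Nonempty (ContinuousMap.HomotopyEquiv X Y) := by
  classical
  obtain ⟨p, ⟨h⟩⟩ := (contractible_iff_id_nullhomotopic A).1 ‹_›
  -- Follow `R` until time `μ x`, when the point has reached `A`; from then on apply the contraction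
  -- of `A` as well, with its clock started at time `μ x`. The two rules agree at that moment
  -- because the contraction starts at the identity.
  let G : I × X → X := fun z =>
    if hz : μ z.2 ≤ z.1 then h (projIcc 0 1 zero_le_one (z.1 - μ z.2), ⟨R z, hRμ z.1 z.2 hz⟩)
    else R z
  have hGc : Continuous G := by
    have hclosed₁ : IsClosed {z : I × X | μ z.2 ≤ z.1} :=
      isClosed_le (hμ.comp continuous_snd) (continuous_subtype_val.comp continuous_fst)
    have hclosed₂ : IsClosed {z : I × X | (z.1 : ℝ) ≤ μ z.2} :=
      isClosed_le (continuous_subtype_val.comp continuous_fst) (hμ.comp continuous_snd)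
    have h₁ : ContinuousOn G {z : I × X | μ z.2 ≤ z.1} := by
      rw [continuousOn_iff_continuous_domRestrict]
      have : Continuous fun z : {z : I × X | μ z.2 ≤ z.1} =>
          (h (projIcc 0 1 zero_le_one (z.1.1 - μ z.1.2),
            (⟨R z.1, hRμ z.1.1 z.1.2 z.2⟩ : A)) : X) := by
        refine continuous_subtype_val.comp (h.continuous.comp (Continuous.prodMk ?_ ?_))
        · refine continuous_projIcc.comp (Continuous.sub ?_ ?_)
          · exact continuous_subtype_val.comp (continuous_fst.comp continuous_subtype_val)
          · exact hμ.comp (continuous_snd.comp continuous_subtype_val)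
        · exact (hR.comp continuous_subtype_val).subtype_mk _
      refine this.congr fun z => ?_
      have hz : μ z.1.2 ≤ z.1.1 := z.2
      simp [G, domRestrict_apply, hz]
    have h₂ : ContinuousOn G {z : I × X | (z.1 : ℝ) ≤ μ z.2} := by
      refine hR.continuousOn.congr fun z hz => ?_
      have hz' : (z.1 : ℝ) ≤ μ z.2 := hz
      by_cases hle : μ z.2 ≤ z.1
      · have h0 : projIcc (0 : ℝ) 1 zero_le_one (z.1 - μ z.2) = 0 :=
          projIcc_of_le_left _ (by linarith)
        simp [G, hle, h0]
      · simp [G, hle]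
    rw [← continuousOn_univ]
    refine (h₁.union_of_isClosed h₂ hclosed₁ hclosed₂).mono fun z _ => ?_
    exact le_total (μ z.2) z.1
  have hG0 : ∀ x, G (0, x) = x := by
    intro x
    by_cases hle : μ x ≤ 0
    · have h0 : μ x = 0 := le_antisymm hle (hμ0 x)
      simp [G, h0, hR0]
    · simp [G, hle, hR0]
  -- The homotopy preserves `A` and ends with a constant map on `A`. The former lets it descend to
  -- the quotient, the latter makes its final map factor through the quotient.
  have hGA : ∀ s, ∀ x ∈ A, G (s, x) ∈ A := by
    intro s x hx
    have hle : μ x ≤ s := (hμA x hx).trans_le s.2.1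
    simp only [G, hle, dif_pos]
    exact Subtype.coe_prop _
  have hG1 : ∀ x ∈ A, G (1, x) = p := by
    intro x hx
    simp [G, hμA x hx]
  have hquot : IsQuotientMap q := .of_surjective_continuous hqs hq
  -- A continuous surjection from a compact space to a Hausdorff space is a quotient map; this also
  -- holds after multiplying by the interval.
  have hquotI : IsQuotientMap (Prod.map id q : I × X → I × Y) :=
    .of_surjective_continuous (Function.surjective_id.prodMap hqs) (continuous_id.prodMap hq)
  -- The section need not be continuous: the composites formed below do not depend on its choice.
  obtain ⟨sec, hsec⟩ := hqs.hasRightInverse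
  have hGsec : ∀ s x, q (G (s, sec (q x))) = q (G (s, x)) := by
    intro s x
    rcases (hqf _ _).1 (hsec (q x)) with heq | ⟨h1, h2⟩
    · rw [heq]
    · exact (hqf _ _).2 (Or.inr ⟨hGA s _ h1, hGA s _ h2⟩)
  have hG1sec : ∀ x, G (1, sec (q x)) = G (1, x) := by
    intro x
    rcases (hqf _ _).1 (hsec (q x)) with heq | ⟨h1, h2⟩
    · rw [heq]
    · rw [hG1 _ h1, hG1 _ h2]
  let g : C(Y, X) := ⟨fun y => G (1, sec y), by
    rw [hquot.continuous_iff]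
    exact (hGc.comp (continuous_const.prodMk continuous_id)).congr fun x => (hG1sec x).symm⟩
  refine ⟨⟨⟨q, hq⟩, g, ?_, ?_⟩⟩
  · refine ContinuousMap.Homotopic.symm ⟨⟨⟨G, hGc⟩, hG0, fun x => ?_⟩⟩
    exact (hG1sec x).symm
  · refine ContinuousMap.Homotopic.symm ⟨⟨⟨fun z => q (G (z.1, sec z.2)), ?_⟩, fun y => ?_,
      fun y => rfl⟩⟩
    · rw [hquotI.continuous_iff]
      exact (hq.comp hGc).congr fun z => (hGsec z.1 z.2).symm
    · exact (congrArg q (hG0 (sec y))).trans (hsec y)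

end CollapseSubspace

/-! ### Wedges of spheres -/

namespace WedgeOfSpheres

variable {m d : ℕ}

/-- The wedge point. -/
def base (m d : ℕ) : WedgeOfSpheres m d := Quot.mk _ (Sum.inl ())

/-- The inclusion of a sphere. -/
def incl (i : Fin m) (z : StdSphere d) : WedgeOfSpheres m d := Quot.mk _ (Sum.inr ⟨i, z⟩)

theorem incl_base (i : Fin m) : incl i (StdSphere.base d) = base m d :=
  (Quot.sound ⟨i, rfl, rfl⟩).symm

theorem continuous_incl (i : Fin m) : Continuous (incl i : StdSphere d → WedgeOfSpheres m d) :=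
  continuous_quot_mk.comp (continuous_inr.comp (continuous_sigmaMk (σ := fun _ => StdSphere d)))

open Classical in
/-- The map from a wedge to the product of its spheres. -/
noncomputable def toPi : WedgeOfSpheres m d → Fin m → StdSphere d :=
  Quot.lift (Sum.elim (fun _ _ => StdSphere.base d)
    fun p => Function.update (fun _ => StdSphere.base d) p.1 p.2) (by
      rintro _ _ ⟨i, rfl, rfl⟩
      simp)

@[simp]
theorem toPi_base : toPi (base m d) = fun _ => StdSphere.base d := rfl

open Classical in
theorem toPi_incl (i : Fin m) (z : StdSphere d) :
    toPi (incl i z) = Function.update (fun _ => StdSphere.base d) i z := rfl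

theorem toPi_incl_same (i : Fin m) (z : StdSphere d) : toPi (incl i z) i = z := by
  classical
  simp [toPi_incl]

theorem toPi_incl_ne {i j : Fin m} (z : StdSphere d) (h : j ≠ i) :
    toPi (incl i z) j = StdSphere.base d := by
  classical
  simp [toPi_incl, h]

theorem eq_base_or_exists (y : WedgeOfSpheres m d) : y = base m d ∨ ∃ i z, y = incl i z := by
  induction y using Quot.ind with
  | mk a =>
    rcases a with ⟨⟩ | ⟨i, z⟩
    · exact Or.inl rfl
    · exact Or.inr ⟨i, z, rfl⟩

theorem continuous_toPi : Continuous (toPi : WedgeOfSpheres m d → Fin m → StdSphere d) := by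
  classical
  refine continuous_quot_lift _ ?_
  refine continuous_sum_dom.2 ⟨continuous_const, continuous_sigma fun i => ?_⟩
  exact continuous_const.update i continuous_id

/-- In the image of the wedge at most one coordinate differs from the base point, and that
coordinate determines the point. -/
theorem toPi_injective :
    Function.Injective (toPi : WedgeOfSpheres m d → Fin m → StdSphere d) := by
  have hbase : ∀ y : WedgeOfSpheres m d, toPi y = toPi (base m d) → y = base m d := by
    intro y hy
    rcases eq_base_or_exists y with rfl | ⟨i, z, rfl⟩
    · rfl
    · have := congrFun hy i
      rw [toPi_incl_same, toPi_base] at this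
      rw [this, incl_base]
  intro y y' hyy
  rcases eq_base_or_exists y with rfl | ⟨i, z, rfl⟩
  · exact (hbase y' hyy.symm).symm
  · rcases eq_base_or_exists y' with rfl | ⟨j, z', rfl⟩
    · exact hbase _ hyy
    · obtain rfl | hij := eq_or_ne i j
      · have := congrFun hyy i
        rw [toPi_incl_same, toPi_incl_same] at this
        rw [this]
      · have h1 := congrFun hyy i
        have h2 := congrFun hyy j
        rw [toPi_incl_same, toPi_incl_ne _ hij] at h1
        rw [toPi_incl_same, toPi_incl_ne _ hij.symm] at h2
        rw [h1, ← h2, incl_base, incl_base]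

instance : CompactSpace (WedgeOfSpheres m d) := by
  unfold WedgeOfSpheres
  infer_instance

instance : T2Space (WedgeOfSpheres m d) := .of_injective_continuous toPi_injective continuous_toPi

/-- This allows continuity of a map into the wedge to be tested on coordinates. -/
theorem isEmbedding_toPi :
    Topology.IsEmbedding (toPi : WedgeOfSpheres m d → Fin m → StdSphere d) :=
  (continuous_toPi.isClosedEmbedding toPi_injective).isEmbedding

instance : ContractibleSpace (WedgeOfSpheres 0 d) := by
  have : Unique (WedgeOfSpheres 0 d) :=
    { default := base 0 d
      uniq := fun y => by
        rcases eq_base_or_exists y with rfl | ⟨i, -⟩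
        · rfl
        · exact i.elim0 }
  infer_instance

/-- Each sphere is a retract of the wedge, by its inclusion and the corresponding coordinate. -/
theorem contractibleSpace_stdSphere [ContractibleSpace (WedgeOfSpheres m d)] (i : Fin m) :
    ContractibleSpace (StdSphere d) := by
  have hid := id_nullhomotopic (WedgeOfSpheres m d)
  let r : C(WedgeOfSpheres m d, StdSphere d) :=
    ⟨fun y => toPi y i, (continuous_apply i).comp continuous_toPi⟩
  let j : C(StdSphere d, WedgeOfSpheres m d) := ⟨incl i, continuous_incl i⟩
  rw [contractible_iff_id_nullhomotopic]
  have h : (r.comp (ContinuousMap.id _)).comp j = ContinuousMap.id (StdSphere d) := by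
    ext1 z
    exact toPi_incl_same i z
  rw [← h]
  exact (hid.comp_right r).comp_left j

end WedgeOfSpheres

/-! ### Collapsing the boundary of a simplex -/

namespace SimplexCollapse

open Finset

variable {d : ℕ}

/-- The smallest coordinate. -/
noncomputable def minCoord (a : Fin (d + 1) → ℝ) : ℝ := univ.inf' univ_nonempty a

theorem minCoord_le (a : Fin (d + 1) → ℝ) (j : Fin (d + 1)) : minCoord a ≤ a j :=
  inf'_le _ (mem_univ j)

theorem exists_eq_minCoord (a : Fin (d + 1) → ℝ) : ∃ j, a j = minCoord a := by
  obtain ⟨j, -, hj⟩ := exists_mem_eq_inf' univ_nonempty a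
  exact ⟨j, hj.symm⟩

theorem le_minCoord {a : Fin (d + 1) → ℝ} {c : ℝ} (h : ∀ j, c ≤ a j) : c ≤ minCoord a :=
  le_inf' _ _ fun j _ => h j

theorem continuous_minCoord : Continuous (minCoord : (Fin (d + 1) → ℝ) → ℝ) :=
  Continuous.finset_inf'_apply univ_nonempty fun i _ => continuous_apply i

/-- The squared norm of the differences to the first coordinate. -/
noncomputable def diffSq (a : Fin (d + 1) → ℝ) : ℝ := ∑ j : Fin d, (a j.succ - a 0) ^ 2

theorem diffSq_nonneg (a : Fin (d + 1) → ℝ) : 0 ≤ diffSq a := sum_nonneg fun _ _ => sq_nonneg _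

/-- The common denominator of the coordinates of `toVec`. -/
noncomputable def denom (a : Fin (d + 1) → ℝ) : ℝ :=
  diffSq a + (1 - ∑ j, a j) + minCoord a ^ 2

/-- A map which sends the interior of the standard simplex bijectively to the complement of the
base point in the sphere (by an inverse stereographic projection), and everything else that
satisfies `Admissible` to the base point. -/
noncomputable def toVec (a : Fin (d + 1) → ℝ) : EuclideanSpace ℝ (Fin (d + 1)) :=
  WithLp.toLp 2 (Fin.cons ((diffSq a + (1 - ∑ j, a j) - minCoord a ^ 2) / denom a)
    fun j => 2 * minCoord a * (a j.succ - a 0) / denom a)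

theorem toVec_zero (a : Fin (d + 1) → ℝ) :
    toVec a 0 = (diffSq a + (1 - ∑ j, a j) - minCoord a ^ 2) / denom a := rfl

theorem toVec_succ (a : Fin (d + 1) → ℝ) (j : Fin d) :
    toVec a j.succ = 2 * minCoord a * (a j.succ - a 0) / denom a := rfl

/-- The restriction of a point of a simplicial complex to the vertices of a maximal simplex. -/
structure Admissible (a : Fin (d + 1) → ℝ) : Prop where
  nonneg : ∀ j, 0 ≤ a j
  sum_le : ∑ j, a j ≤ 1
  sum_eq : 0 < minCoord a → ∑ j, a j = 1

namespace Admissible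

variable {a : Fin (d + 1) → ℝ}

theorem minCoord_nonneg (h : Admissible a) : 0 ≤ minCoord a := le_minCoord h.nonneg

/-- All three summands are nonnegative. If all vanished, the coordinates would be equal with minimum
zero, contradicting that their sum is one. The summand `1 - ∑ j, a j` takes care of points away from
the simplex. -/
theorem denom_pos (h : Admissible a) : 0 < denom a := by
  have h1 := diffSq_nonneg a
  have h2 := h.sum_le
  rcases h.minCoord_nonneg.eq_or_lt with h0 | hpos
  · by_contra hneg
    unfold denom at hneg
    have hκ : ∑ j, a j = 1 := by nlinarith [sq_nonneg (minCoord a)]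
    have hy : diffSq a = 0 := by nlinarith [sq_nonneg (minCoord a)]
    have hconst : ∀ j, a j = a 0 := by
      intro j
      refine Fin.cases rfl (fun j => ?_) j
      have := (sum_eq_zero_iff_of_nonneg fun _ _ => sq_nonneg _).1 hy j (mem_univ j)
      exact sub_eq_zero.1 (pow_eq_zero_iff two_ne_zero |>.1 this)
    obtain ⟨j, hj⟩ := exists_eq_minCoord a
    have hzero : ∀ i, a i = 0 := fun i => by rw [hconst i, ← hconst j, hj, ← h0]
    simp [hzero] at hκ
  · unfold denom
    have := pow_pos hpos 2
    linarith

/-- With `A = diffSq a + κ` and `m = minCoord a`, the identity `(A - m²)² + 4m² diffSq a = (A +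
m²)²` holds up to `4m²κ`. This vanishes because `κ = 1 - ∑ j, a j` is zero whenever `m > 0`. -/
theorem norm_toVec (h : Admissible a) : ‖toVec a‖ = 1 := by
  have hκ : (1 - ∑ j, a j) * minCoord a = 0 := by
    rcases h.minCoord_nonneg.eq_or_lt with h0 | hpos
    · rw [← h0, mul_zero]
    · rw [h.sum_eq hpos, sub_self, zero_mul]
  have hN := h.denom_pos.ne'
  rw [EuclideanSpace.norm_eq, Real.sqrt_eq_one, Fin.sum_univ_succ, toVec_zero]
  simp only [toVec_succ, Real.norm_eq_abs, sq_abs, div_pow, mul_pow]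
  rw [← sum_div, ← mul_sum, ← add_div, div_eq_one_iff_eq (pow_ne_zero 2 hN)]
  change _ + 2 ^ 2 * minCoord a ^ 2 * diffSq a = _
  unfold denom
  linear_combination (-4 * minCoord a) * hκ

theorem toVec_eq_base_iff (h : Admissible a) :
    toVec a = EuclideanSpace.single 0 1 ↔ minCoord a = 0 := by
  have hN := h.denom_pos.ne'
  constructor
  · intro heq
    have h0 : toVec a 0 = 1 := by rw [heq]; simp
    rw [toVec_zero, div_eq_one_iff_eq hN] at h0
    unfold denom at h0
    have : minCoord a ^ 2 = 0 := by linarith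
    exact pow_eq_zero_iff two_ne_zero |>.1 this
  · intro h0
    ext j
    refine Fin.cases ?_ (fun j => ?_) j
    · rw [toVec_zero, div_eq_iff hN]
      simp [denom, h0]
    · rw [toVec_succ, h0]
      simp

/-- Stereographic projection recovers the differences `a j - a 0` divided by the minimum. Together
with the minimum these fix the vector up to scale, and the sum fixes the scale. -/
theorem eq_of_toVec_eq {b : Fin (d + 1) → ℝ} (ha : Admissible a) (hb : Admissible b)
    (hpos : 0 < minCoord a) (heq : toVec a = toVec b) : a = b := by
  have hposb : 0 < minCoord b := by
    refine hb.minCoord_nonneg.lt_of_ne fun h0 => hpos.ne' ?_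
    rw [← ha.toVec_eq_base_iff, heq, hb.toVec_eq_base_iff, h0]
  have hstereo : ∀ {c : Fin (d + 1) → ℝ}, Admissible c → 0 < minCoord c → ∀ j : Fin d,
      c j.succ - c 0 = minCoord c * (toVec c j.succ / (1 - toVec c 0)) := by
    intro c hc hcpos j
    have hN := hc.denom_pos.ne'
    have h1 : 1 - toVec c 0 = 2 * minCoord c ^ 2 / denom c := by
      rw [toVec_zero, eq_div_iff hN, sub_mul, div_mul_cancel₀ _ hN]
      unfold denom
      ring
    rw [h1, toVec_succ]
    have := hcpos.ne'
    field_simp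
  have hdiff : ∀ j, a j * minCoord b - a 0 * minCoord b =
      b j * minCoord a - b 0 * minCoord a := by
    intro j
    refine Fin.cases (by ring) (fun j => ?_) j
    have h1 := hstereo ha hpos j
    have h2 := hstereo hb hposb j
    rw [heq] at h1
    linear_combination minCoord b * h1 - minCoord a * h2
  -- Evaluating `hdiff` where `a` is minimal gives one inequality, and where `b` is minimal the
  -- other.
  have h0 : a 0 * minCoord b = b 0 * minCoord a := by
    obtain ⟨i, hi⟩ := exists_eq_minCoord a
    obtain ⟨j, hj⟩ := exists_eq_minCoord b
    have hi' := hdiff i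
    have hj' := hdiff j
    have h1 := mul_le_mul_of_nonneg_right (minCoord_le b i) hpos.le
    have h2 := mul_le_mul_of_nonneg_right (minCoord_le a j) hposb.le
    rw [hi] at hi'
    rw [hj] at hj'
    linarith
  have hprop : ∀ j, a j * minCoord b = b j * minCoord a := fun j => by
    have := hdiff j
    linarith
  have hmin : minCoord b = minCoord a := by
    have := sum_congr rfl fun j (_ : j ∈ univ) => hprop j
    rwa [← sum_mul, ← sum_mul, ha.sum_eq hpos, hb.sum_eq hposb, one_mul, one_mul] at this
  funext j
  have := hprop j
  rw [hmin] at this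
  exact mul_right_cancel₀ hpos.ne' this

end Admissible

/-- Project `z` stereographically, use the result as differences to a first coordinate zero, shift
so that the minimum is one, and divide by the sum. -/
theorem exists_toVec_eq (z : EuclideanSpace ℝ (Fin (d + 1))) (hz : ‖z‖ = 1)
    (hne : z ≠ EuclideanSpace.single 0 1) :
    ∃ a : Fin (d + 1) → ℝ, Admissible a ∧ 0 < minCoord a ∧ toVec a = z := by
  have hsum : z 0 ^ 2 + ∑ j : Fin d, z j.succ ^ 2 = 1 := by
    rw [EuclideanSpace.norm_eq, Real.sqrt_eq_one, Fin.sum_univ_succ] at hz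
    simpa using hz
  have hz0 : z 0 ≠ 1 := by
    intro h0
    refine hne ?_
    have h1 : ∑ j : Fin d, z j.succ ^ 2 = 0 := by rw [h0] at hsum; linarith
    ext j
    refine Fin.cases (by simp [h0]) (fun j => ?_) j
    have := (sum_eq_zero_iff_of_nonneg fun _ _ => sq_nonneg _).1 h1 j (mem_univ j)
    simpa using this
  have hz1 : 1 - z 0 ≠ 0 := sub_ne_zero.2 hz0.symm
  let w : Fin (d + 1) → ℝ := Fin.cons 0 fun j => z j.succ / (1 - z 0)
  let b : Fin (d + 1) → ℝ := fun j => w j - minCoord w + 1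
  let S : ℝ := ∑ j, b j
  have hb1 : ∀ j, 1 ≤ b j := fun j => by
    have := minCoord_le w j
    simp only [b]; linarith
  have hS : 0 < S := sum_pos (fun j _ => by linarith [hb1 j]) univ_nonempty
  let a : Fin (d + 1) → ℝ := fun j => b j / S
  have hsuma : ∑ j, a j = 1 := by
    simp only [a]
    rw [← sum_div]
    exact div_self hS.ne'
  have hmin : minCoord a = 1 / S := by
    refine le_antisymm ?_ (le_minCoord fun j => div_le_div_of_nonneg_right (hb1 j) hS.le)
    obtain ⟨j, hj⟩ := exists_eq_minCoord w
    refine (minCoord_le a j).trans_eq ?_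
    simp [a, b, hj]
  have hdiff : ∀ j : Fin d, a j.succ - a 0 = z j.succ / (1 - z 0) / S := by
    intro j
    simp only [a, b, w, Fin.cons_succ, Fin.cons_zero]
    ring
  have hdsq : diffSq a = (1 + z 0) / (1 - z 0) / S ^ 2 := by
    unfold diffSq
    simp only [hdiff, div_pow]
    rw [← sum_div, ← sum_div]
    have : ∑ j : Fin d, z j.succ ^ 2 = (1 + z 0) * (1 - z 0) := by linarith
    rw [this]
    field_simp
  have hden : denom a = 2 / (1 - z 0) / S ^ 2 := by
    unfold denom
    rw [hdsq, hsuma, hmin]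
    have := hS.ne'
    field_simp
    ring
  refine ⟨a, ⟨fun j => ?_, hsuma.le, fun _ => hsuma⟩, by rw [hmin]; positivity, ?_⟩
  · exact div_nonneg (by linarith [hb1 j]) hS.le
  · have hS' := hS.ne'
    ext j
    refine Fin.cases ?_ (fun j => ?_) j
    · rw [toVec_zero, hden, hdsq, hsuma, hmin]
      field_simp
      ring
    · rw [toVec_succ, hden, hdiff, hmin]
      field_simp

theorem continuousOn_toVec :
    ContinuousOn (toVec : (Fin (d + 1) → ℝ) → _) {a | Admissible a} := by
  have h1 : Continuous (diffSq : (Fin (d + 1) → ℝ) → ℝ) := by unfold diffSq; fun_prop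
  have h2 := continuous_minCoord (d := d)
  have h3 : Continuous (denom : (Fin (d + 1) → ℝ) → ℝ) := by unfold denom; fun_prop
  refine (PiLp.continuous_toLp 2 _).comp_continuousOn (continuousOn_pi.2 fun j => ?_)
  have hne : ∀ a ∈ {a : Fin (d + 1) → ℝ | Admissible a}, denom a ≠ 0 := fun a ha =>
    (Admissible.denom_pos ha).ne'
  refine Fin.cases ?_ (fun j => ?_) j
  · simp only [Fin.cons_zero]
    exact ContinuousOn.div (by fun_prop) h3.continuousOn hne
  · simp only [Fin.cons_succ]
    exact ContinuousOn.div (by fun_prop) h3.continuousOn hne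

end SimplexCollapse

/-! ### Wedges of spheres from complexes with maximal simplices removed -/

section WedgeRealization

open Finset SimplexCollapse

variable {V : Type*} [Fintype V] [DecidableEq V] {K : Set (Finset V)} {m d : ℕ}

namespace Realization

/-- The smallest of the barycentric coordinates at the vertices of a simplex. -/
noncomputable def minOn (σ : Fin (d + 1) → V) (t : V → ℝ) : ℝ := minCoord (t ∘ σ)

omit [Fintype V] [DecidableEq V] in
theorem continuous_minOn (σ : Fin (d + 1) → V) : Continuous (minOn σ) :=
  continuous_minCoord.comp (continuous_pi fun j => continuous_apply (σ j))

omit [DecidableEq V] in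
theorem minOn_nonneg (σ : Fin (d + 1) → V) (t : Realization K) : 0 ≤ minOn σ t.1 :=
  le_minCoord fun j => t.2.1 (σ j)

theorem minOn_pos_iff {σ : Fin (d + 1) → V}
    (hmax : ∀ τ ∈ K, univ.image σ ⊆ τ → τ = univ.image σ) (t : Realization K) :
    0 < minOn σ t.1 ↔ coordSupport t.1 = univ.image σ := by
  constructor
  · intro hpos
    refine hmax _ t.2.2.2 fun w hw => ?_
    obtain ⟨j, -, rfl⟩ := mem_image.1 hw
    exact mem_coordSupport.2 (hpos.trans_le (minCoord_le (t.1 ∘ σ) j)).ne'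
  · intro hsupp
    obtain ⟨j, hj⟩ := exists_eq_minCoord (t.1 ∘ σ)
    unfold minOn
    rw [← hj]
    refine (t.2.1 (σ j)).lt_of_ne (Ne.symm ?_)
    rw [← mem_coordSupport, hsupp]
    exact mem_image_of_mem σ (mem_univ j)

theorem minOn_eq_zero {σ : Fin (d + 1) → V}
    (hmax : ∀ τ ∈ K, univ.image σ ⊆ τ → τ = univ.image σ) {t : Realization K}
    (ht : coordSupport t.1 ≠ univ.image σ) : minOn σ t.1 = 0 :=
  le_antisymm (not_lt.1 fun h => ht ((minOn_pos_iff hmax t).1 h)) (minOn_nonneg σ t)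

omit [DecidableEq V] in
theorem sum_le_one {σ : Fin (d + 1) → V} (hσ : Function.Injective σ) (t : Realization K) :
    ∑ j, t.1 (σ j) ≤ 1 :=
  calc ∑ j, t.1 (σ j) = ∑ w ∈ univ.map ⟨σ, hσ⟩, t.1 w := (sum_map univ ⟨σ, hσ⟩ t.1).symm
    _ ≤ ∑ w, t.1 w := sum_le_sum_of_subset_of_nonneg (subset_univ _) fun w _ _ => t.2.1 w
    _ = 1 := t.2.2.1

theorem sum_eq_one {σ : Fin (d + 1) → V} (hσ : Function.Injective σ) {t : Realization K}
    (ht : coordSupport t.1 = univ.image σ) : ∑ j, t.1 (σ j) = 1 := by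
  rw [← sum_image (g := σ) (f := t.1) hσ.injOn, ← ht]
  refine Eq.trans (sum_subset (subset_univ _) fun w _ hw => ?_) t.2.2.1
  simpa using hw

theorem admissible {σ : Fin (d + 1) → V} (hσ : Function.Injective σ)
    (hmax : ∀ τ ∈ K, univ.image σ ⊆ τ → τ = univ.image σ) (t : Realization K) :
    Admissible (t.1 ∘ σ) :=
  ⟨fun j => t.2.1 (σ j), sum_le_one hσ t,
    fun hpos => sum_eq_one hσ ((minOn_pos_iff hmax t).1 hpos)⟩

/-- Pushes the points in the interior of one of the simplices `σ i` away from its barycentre, until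
a coordinate vanishes or the coordinates have been decreased by `c` (before normalisation). -/
noncomputable def pushOut (σ : Fin m → Fin (d + 1) → V) (c : ℝ) (t : V → ℝ) : V → ℝ := fun w =>
  (t w - ∑ i, if w ∈ univ.image (σ i) then min (minOn (σ i) t) c else 0) /
    (1 - (d + 1) * ∑ i, min (minOn (σ i) t) c)

variable {σ : Fin m → Fin (d + 1) → V}

theorem pushOut_eq_self (hmax : ∀ i, ∀ τ ∈ K, univ.image (σ i) ⊆ τ → τ = univ.image (σ i))
    {c : ℝ} (hc : 0 ≤ c) {t : Realization K} (ht : ∀ i, coordSupport t.1 ≠ univ.image (σ i)) :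
    pushOut σ c t.1 = t.1 := by
  have h0 : ∀ i, min (minOn (σ i) t.1) c = 0 := fun i => by
    rw [minOn_eq_zero (hmax i) (ht i), min_eq_left hc]
  funext w
  simp [pushOut, h0]

theorem pushOut_zero (t : Realization K) : pushOut σ 0 t.1 = t.1 := by
  have h0 : ∀ i, min (minOn (σ i) t.1) 0 = 0 := fun i => min_eq_right (minOn_nonneg (σ i) t)
  funext w
  simp [pushOut, h0]

theorem pushOut_apply (hmax : ∀ i, ∀ τ ∈ K, univ.image (σ i) ⊆ τ → τ = univ.image (σ i))
    (hinj : Function.Injective fun i => univ.image (σ i)) {c : ℝ} (hc : 0 ≤ c)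
    {t : Realization K} {i : Fin m} (ht : coordSupport t.1 = univ.image (σ i)) (w : V) :
    pushOut σ c t.1 w =
      (t.1 w - if w ∈ univ.image (σ i) then min (minOn (σ i) t.1) c else 0) /
        (1 - (d + 1) * min (minOn (σ i) t.1) c) := by
  have h0 : ∀ j, j ≠ i → min (minOn (σ j) t.1) c = 0 := fun j hj => by
    rw [minOn_eq_zero (hmax j) (fun h => hj (hinj (h.symm.trans ht))), min_eq_left hc]
  unfold pushOut
  rw [sum_eq_single i (fun j _ hj => by simp [h0 j hj]) (by simp),
    sum_eq_single i (fun j _ hj => h0 j hj) (by simp)]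

/-- Only the simplex whose interior contains the point contributes. Subtracting the same amount from
its `d + 1` coordinates lowers the sum by exactly what the denominator compensates. -/
theorem pushOut_mem (hσ : ∀ i, Function.Injective (σ i))
    (hmax : ∀ i, ∀ τ ∈ K, univ.image (σ i) ⊆ τ → τ = univ.image (σ i))
    (hinj : Function.Injective fun i => univ.image (σ i)) {c : ℝ} (hc : 0 ≤ c)
    (hcd : (d + 1) * c < 1) (t : Realization K) :
    (∀ w, 0 ≤ pushOut σ c t.1 w) ∧ ∑ w, pushOut σ c t.1 w = 1 ∧
      coordSupport (pushOut σ c t.1) ⊆ coordSupport t.1 := by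
  by_cases hA : ∀ i, coordSupport t.1 ≠ univ.image (σ i)
  · rw [pushOut_eq_self hmax hc hA]
    exact ⟨t.2.1, t.2.2.1, subset_rfl⟩
  push Not at hA
  obtain ⟨i, hi⟩ := hA
  have happ := pushOut_apply hmax hinj hc hi
  set μ := min (minOn (σ i) t.1) c with hμ
  have hμ0 : 0 ≤ μ := le_min (minOn_nonneg _ t) hc
  have hμd : (d + 1) * μ < 1 :=
    (mul_le_mul_of_nonneg_left (min_le_right _ _) (by positivity)).trans_lt hcd
  have hden : 0 < 1 - (d + 1) * μ := by linarith
  refine ⟨fun w => ?_, ?_, fun w hw => ?_⟩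
  · rw [happ]
    refine div_nonneg ?_ hden.le
    split_ifs with hw
    · obtain ⟨j, -, rfl⟩ := mem_image.1 hw
      exact sub_nonneg.2 ((min_le_left _ _).trans (minCoord_le (t.1 ∘ σ i) j))
    · simpa using t.2.1 w
  · simp only [happ]
    rw [← sum_div, sum_sub_distrib, t.2.2.1, ← sum_filter, sum_const, nsmul_eq_mul]
    have hcard : #(univ.filter fun w => w ∈ univ.image (σ i)) = d + 1 := by
      rw [filter_univ_mem, card_image_of_injective _ (hσ i), card_univ, Fintype.card_fin]
    rw [hcard, Nat.cast_add_one]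
    exact div_self hden.ne'
  · rw [mem_coordSupport] at hw ⊢
    intro hw0
    have hwi : w ∉ univ.image (σ i) := by
      rw [← hi, mem_coordSupport, not_not]; exact hw0
    rw [happ, hw0, if_neg hwi, sub_zero, zero_div] at hw
    exact hw rfl

/-- Once `c` is at least the minimum, the smallest coordinate has become zero and the point lies on
the boundary of its simplex. -/
theorem pushOut_not_face (hσ : ∀ i, Function.Injective (σ i))
    (hmax : ∀ i, ∀ τ ∈ K, univ.image (σ i) ⊆ τ → τ = univ.image (σ i))
    (hinj : Function.Injective fun i => univ.image (σ i)) {c : ℝ} (hc : 0 ≤ c)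
    (hcd : (d + 1) * c < 1) {t : Realization K} (ht : ∀ i, minOn (σ i) t.1 ≤ c) (i : Fin m) :
    coordSupport (pushOut σ c t.1) ≠ univ.image (σ i) := by
  intro hface
  have hsub := (pushOut_mem hσ hmax hinj hc hcd t).2.2
  have hi : coordSupport t.1 = univ.image (σ i) := hmax i _ t.2.2.2 (hface ▸ hsub)
  obtain ⟨j, hj⟩ := exists_eq_minCoord (t.1 ∘ σ i)
  have hmem : σ i j ∈ univ.image (σ i) := mem_image_of_mem _ (mem_univ j)
  have hne : σ i j ∈ coordSupport (pushOut σ c t.1) := hface ▸ hmem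
  rw [mem_coordSupport, pushOut_apply hmax hinj hc hi, if_pos hmem, min_eq_left (ht i)] at hne
  refine hne ?_
  have : t.1 (σ i j) = minOn (σ i) t.1 := hj
  rw [this, sub_self, zero_div]

omit [DecidableEq V] in
-- As `K` is closed under subsets, the support condition is a finite union over `τ ∈ K` of the
-- closed conditions of vanishing off `τ`.
theorem isClosed_coordSupport_mem (hK : IsLowerSet K) : 
    IsClosed {t : V → ℝ | (∀ v, 0 ≤ t v) ∧ ∑ v, t v = 1 ∧ coordSupport t ∈ K} := by
  have hmem : {t : V → ℝ | coordSupport t ∈ K} = ⋃ τ ∈ K, {t | ∀ v ∉ τ, t v = 0} := by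
    ext t
    simp only [Set.mem_ofPred_eq, Set.mem_iUnion, exists_prop]
    constructor
    · exact fun ht => ⟨_, ht, fun v hv => by simpa using hv⟩
    · rintro ⟨τ, hτ, h⟩
      refine hK (fun v hv => ?_) hτ
      by_contra hvτ
      exact mem_coordSupport.1 hv (h v hvτ)
  have hclosed : IsClosed {t : V → ℝ | coordSupport t ∈ K} := by
    rw [hmem]
    refine Set.Finite.isClosed_biUnion (Set.toFinite K) fun τ _ => ?_
    simp only [Set.ofPred_forall]
    exact isClosed_iInter fun v => isClosed_iInter fun _ =>
      isClosed_eq (continuous_apply v) continuous_const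
  refine IsClosed.inter ?_ (IsClosed.inter ?_ hclosed)
  · change IsClosed {t : V → ℝ | ∀ v, 0 ≤ t v}
    simp only [Set.ofPred_forall]
    exact isClosed_iInter fun v => isClosed_le continuous_const (continuous_apply v)
  · exact isClosed_eq (by fun_prop) continuous_const

omit [DecidableEq V] in
theorem compactSpace (hK : IsLowerSet K) : CompactSpace (Realization K) := by
  refine isCompact_iff_compactSpace.1 ((isCompact_univ_pi fun _ : V =>
    isCompact_Icc (a := (0 : ℝ)) (b := 1)).of_isClosed_subset (isClosed_coordSupport_mem hK) ?_)
  rintro t ⟨h0, h1, -⟩ v -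
  exact ⟨h0 v, h1 ▸ single_le_sum (fun w _ => h0 w) (mem_univ v)⟩

/-- A simplicial complex which becomes contractible after the removal of the interiors of some
maximal simplices of dimension `d` is homotopy equivalent to a wedge of `d`-spheres. -/
theorem nonempty_homotopyEquiv_wedgeOfSpheres (hK : IsLowerSet K)
    (hσ : ∀ i, Function.Injective (σ i)) (hface : ∀ i, univ.image (σ i) ∈ K)
    (hmax : ∀ i, ∀ τ ∈ K, univ.image (σ i) ⊆ τ → τ = univ.image (σ i))
    (hinj : Function.Injective fun i => univ.image (σ i))
    [ContractibleSpace (Realization {τ ∈ K | ∀ i, τ ≠ univ.image (σ i)})] :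
    Nonempty (ContinuousMap.HomotopyEquiv (Realization K) (WedgeOfSpheres m d)) := by
  have := compactSpace hK
  -- `A` is the complement of the open simplices, to be collapsed to the wedge point.
  let A : Set (Realization K) := {t | ∀ i, coordSupport t.1 ≠ univ.image (σ i)}
  let eA : A ≃ₜ Realization {τ ∈ K | ∀ i, τ ≠ univ.image (σ i)} :=
    { toFun := fun t => ⟨t.1.1, t.1.2.1, t.1.2.2.1, t.1.2.2.2, t.2⟩
      invFun := fun t => ⟨⟨t.1, t.2.1, t.2.2.1, t.2.2.2.1⟩, t.2.2.2.2⟩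
      left_inv := fun t => rfl
      right_inv := fun t => rfl
      continuous_toFun := (continuous_val.comp continuous_subtype_val).subtype_mk _
      continuous_invFun := (continuous_val.subtype_mk _).subtype_mk _ }
  have : ContractibleSpace A := eA.contractibleSpace
  -- The collar.
  let ε : ℝ := 1 / (2 * (d + 1))
  have hε : 0 < ε := by positivity
  have hc0 : ∀ s : unitInterval, 0 ≤ s * ε := fun s => mul_nonneg s.2.1 hε.le
  have hcd : ∀ s : unitInterval, (d + 1) * ((s : ℝ) * ε) < 1 := fun s => by
    have h1 : (d + 1) * ε = 1 / 2 := by simp only [ε]; field_simp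
    have h2 := s.2.2
    calc (d + 1) * ((s : ℝ) * ε) = s * ((d + 1) * ε) := by ring
      _ < 1 := by rw [h1]; linarith
  let R : unitInterval × Realization K → Realization K := fun z =>
    ⟨pushOut σ (z.1 * ε) z.2.1, (pushOut_mem hσ hmax hinj (hc0 z.1) (hcd z.1) z.2).1,
      (pushOut_mem hσ hmax hinj (hc0 z.1) (hcd z.1) z.2).2.1,
      hK (pushOut_mem hσ hmax hinj (hc0 z.1) (hcd z.1) z.2).2.2 z.2.2.2.2⟩
  have hR : Continuous R := by
    have hmin : ∀ i, Continuous fun z : unitInterval × Realization K =>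
        min (minOn (σ i) z.2.1) (z.1 * ε) := fun i =>
      ((continuous_minOn (σ i)).comp (continuous_val.comp continuous_snd)).min
        ((continuous_subtype_val.comp continuous_fst).mul continuous_const)
    refine Continuous.subtype_mk (continuous_pi fun w => ?_) _
    refine Continuous.div ?_ ?_ fun z => ?_
    · refine ((continuous_coord w).comp continuous_snd).sub
        (continuous_finsetSum _ fun i _ => ?_)
      split_ifs
      · exact hmin i
      · exact continuous_const
    · exact continuous_const.sub
        (continuous_const.mul (continuous_finsetSum _ fun i _ => hmin i))
    · by_cases hA : ∀ i, coordSupport z.2.1 ≠ univ.image (σ i)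
      · have h0 : ∀ i, min (minOn (σ i) z.2.1) (z.1 * ε) = 0 := fun i => by
          rw [minOn_eq_zero (hmax i) (hA i), min_eq_left (hc0 z.1)]
        simp [h0]
      · push Not at hA
        obtain ⟨i, hi⟩ := hA
        rw [sum_eq_single i (fun j _ hj => ?_) (by simp)]
        · have h1 : (d + 1) * min (minOn (σ i) z.2.1) (z.1 * ε) ≤ (d + 1) * (z.1 * ε) :=
            mul_le_mul_of_nonneg_left (min_le_right _ _) (by positivity)
          have h2 := hcd z.1
          exact (by linarith : 0 < 1 - (d + 1) * min (minOn (σ i) z.2.1) (z.1 * ε)).ne'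
        · rw [minOn_eq_zero (hmax j) (fun h => hj (hinj (h.symm.trans hi))),
            min_eq_left (hc0 z.1)]
  -- If `μ t ≤ s`, then every minimum is at most `s * ε`, so that by time `s` the point has been
  -- pushed into `A`.
  let μ : Realization K → ℝ := fun t => (∑ i, minOn (σ i) t.1) / ε
  have hμ : Continuous μ := (continuous_finsetSum _ fun i _ =>
    (continuous_minOn (σ i)).comp continuous_val).div_const ε
  have hμle : ∀ (s : unitInterval) t, μ t ≤ s → ∀ i, minOn (σ i) t.1 ≤ s * ε := by
    intro s t hle i
    rw [div_le_iff₀ hε] at hle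
    exact (single_le_sum (f := fun i => minOn (σ i) t.1) (fun j _ => minOn_nonneg (σ j) t)
      (mem_univ i)).trans hle
  -- The quotient map.
  have hadm : ∀ i (t : Realization K), Admissible (t.1 ∘ σ i) := fun i t =>
    admissible (hσ i) (hmax i) t
  let Θ : Realization K → Fin m → StdSphere d := fun t i =>
    ⟨toVec (t.1 ∘ σ i), by rw [mem_sphere_zero_iff_norm]; exact (hadm i t).norm_toVec⟩
  have hΘc : Continuous Θ := by
    refine continuous_pi fun i => Continuous.subtype_mk ?_ _
    exact continuousOn_toVec.comp_continuous
      (continuous_pi fun j => continuous_coord (σ i j)) fun t => hadm i t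
  have hΘbase : ∀ t i, Θ t i = StdSphere.base d ↔ coordSupport t.1 ≠ univ.image (σ i) := by
    intro t i
    rw [Subtype.ext_iff]
    refine (hadm i t).toVec_eq_base_iff.trans ?_
    rw [Ne, ← minOn_pos_iff (hmax i) t, not_lt]
    exact ⟨fun h => h.le, fun h => le_antisymm h (minOn_nonneg _ t)⟩
  -- A point lies in the interior of at most one of the simplices, so at most one coordinate of `Θ
  -- t` is not the base point.
  have hex : ∀ t, ∃ y : WedgeOfSpheres m d, y.toPi = Θ t := by
    intro t
    by_cases hA : ∀ i, coordSupport t.1 ≠ univ.image (σ i)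
    · refine ⟨.base m d, ?_⟩
      funext i
      exact ((hΘbase t i).2 (hA i)).symm
    · push Not at hA
      obtain ⟨i, hi⟩ := hA
      refine ⟨.incl i (Θ t i), ?_⟩
      funext j
      obtain rfl | hj := eq_or_ne j i
      · exact WedgeOfSpheres.toPi_incl_same _ _
      · rw [WedgeOfSpheres.toPi_incl_ne _ hj]
        exact ((hΘbase t j).2 fun h => hj (hinj (h.symm.trans hi))).symm
  choose q hq using hex
  have hqeq : ∀ x y, q x = q y ↔ Θ x = Θ y := fun x y => by
    rw [← hq, ← hq, WedgeOfSpheres.toPi_injective.eq_iff]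
  refine nonempty_homotopyEquiv_of_collar A hR hμ (fun t => ?_) (fun t ht => ?_) (fun t => ?_)
    (fun s t hle => ?_) (q := q) ?_ ?_ ?_
  · exact div_nonneg (sum_nonneg fun i _ => minOn_nonneg (σ i) t) hε.le
  · simp only [μ]
    rw [sum_eq_zero fun i _ => minOn_eq_zero (hmax i) (ht i), zero_div]
  · refine Subtype.ext ?_
    simp only [R, Set.Icc.coe_zero, zero_mul]
    exact pushOut_zero t
  · exact pushOut_not_face hσ hmax hinj (hc0 s) (hcd s) (hμle s t hle)
  · rw [WedgeOfSpheres.isEmbedding_toPi.continuous_iff]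
    exact hΘc.congr fun t => (hq t).symm
  · intro y
    have hbase : ∃ t, q t = .base m d := by
      obtain ⟨t⟩ := (inferInstance : Nonempty A)
      refine ⟨t.1, WedgeOfSpheres.toPi_injective ?_⟩
      rw [hq]
      funext i
      exact (hΘbase t.1 i).2 (t.2 i)
    rcases WedgeOfSpheres.eq_base_or_exists y with rfl | ⟨i, z, rfl⟩
    · exact hbase
    · by_cases hz : z = StdSphere.base d
      · rw [hz, WedgeOfSpheres.incl_base]; exact hbase
      obtain ⟨a, ha, hpos, haz⟩ := exists_toVec_eq z.1 (by simp)
        fun h => hz (Subtype.ext h)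
      let t : V → ℝ := Function.extend (σ i) a 0
      have htσ : t ∘ σ i = a := funext fun j => (hσ i).extend_apply _ _ _
      have ht0 : ∀ w, w ∉ Set.range (σ i) → t w = 0 := fun w hw =>
        Function.extend_apply' _ _ _ hw
      have hsupp : coordSupport t ⊆ univ.image (σ i) := by
        intro w hw
        by_contra hwi
        exact mem_coordSupport.1 hw (ht0 w fun ⟨j, hj⟩ =>
          hwi (mem_image.2 ⟨j, mem_univ j, hj⟩))
      have ht : (∀ v, 0 ≤ t v) ∧ ∑ v, t v = 1 ∧ coordSupport t ∈ K := by
        refine ⟨fun v => ?_, ?_, hK hsupp (hface i)⟩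
        · by_cases hv : v ∈ Set.range (σ i)
          · obtain ⟨j, rfl⟩ := hv
            exact (ha.nonneg j).trans_eq (congrFun htσ j).symm
          · rw [ht0 v hv]
        · rw [← ha.sum_eq hpos, ← htσ]
          refine Eq.trans (sum_subset (subset_univ (univ.image (σ i))) fun w _ hw => ?_).symm
            (sum_image (hσ i).injOn)
          exact ht0 w fun ⟨j, hj⟩ => hw (mem_image.2 ⟨j, mem_univ j, hj⟩)
      have hΘi : Θ ⟨t, ht⟩ i = z := Subtype.ext (by simp only [Θ, htσ]; exact haz)
      have hti : coordSupport t = univ.image (σ i) := by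
        by_contra hne
        exact hz (hΘi ▸ (hΘbase ⟨t, ht⟩ i).2 hne)
      refine ⟨⟨t, ht⟩, WedgeOfSpheres.toPi_injective ((hq _).trans ?_)⟩
      funext j
      obtain rfl | hj := eq_or_ne j i
      · rw [WedgeOfSpheres.toPi_incl_same, hΘi]
      · rw [WedgeOfSpheres.toPi_incl_ne _ hj]
        exact (hΘbase ⟨t, ht⟩ j).2 fun h => hj (hinj (h.symm.trans hti))
  · intro x y
    rw [hqeq]
    constructor
    · intro hxy
      have hAiff : ∀ i, coordSupport x.1 ≠ univ.image (σ i) ↔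
          coordSupport y.1 ≠ univ.image (σ i) := fun i => by
        rw [← hΘbase, ← hΘbase, hxy]
      by_cases hx : x ∈ A
      · exact Or.inr ⟨hx, fun i => (hAiff i).1 (hx i)⟩
      · left
        have hx' : ∃ i, coordSupport x.1 = univ.image (σ i) := by
          by_contra hne
          exact hx fun i hi => hne ⟨i, hi⟩
        obtain ⟨i, hi⟩ := hx'
        have hiy : coordSupport y.1 = univ.image (σ i) := by
          by_contra hne
          exact (hAiff i).2 hne hi
        have heq : x.1 ∘ σ i = y.1 ∘ σ i := (hadm i x).eq_of_toVec_eq (hadm i y)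
          ((minOn_pos_iff (hmax i) x).2 hi) (congrArg Subtype.val (congrFun hxy i))
        refine Subtype.ext (funext fun w => ?_)
        by_cases hw : w ∈ univ.image (σ i)
        · obtain ⟨j, -, rfl⟩ := mem_image.1 hw
          exact congrFun heq j
        · have h1 : x.1 w = 0 := by rw [← hi, mem_coordSupport, not_not] at hw; exact hw
          have h2 : y.1 w = 0 := by rw [← hiy, mem_coordSupport, not_not] at hw; exact hw
          rw [h1, h2]
    · rintro (rfl | ⟨hx, hy⟩)
      · rfl
      · funext i
        rw [(hΘbase x i).2 (hx i), (hΘbase y i).2 (hy i)]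

end Realization

end WedgeRealization

/-! ### Spheres are not contractible -/

section NoRetraction

open Polynomial MeasureTheory Metric Set

/-- Lagrange interpolation. A fixed linear combination of values at small parameters gives the value
at one, which carries an integral identity from small parameters to one. -/
theorem Polynomial.exists_weights_eval_one (n : ℕ) (t : Fin (n + 1) → ℝ)
    (ht : Function.Injective t) :
    ∃ c : Fin (n + 1) → ℝ, ∀ p : ℝ[X], p.natDegree ≤ n →
      p.eval 1 = ∑ i, c i * p.eval (t i) := by
  refine ⟨fun i => (Lagrange.basis Finset.univ t i).eval 1, fun p hp => ?_⟩
  have hdeg : p.degree < (Finset.univ : Finset (Fin (n + 1))).card := by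
    refine lt_of_le_of_lt p.degree_le_natDegree ?_
    simp only [Finset.card_univ, Fintype.card_fin]
    exact_mod_cast Nat.lt_succ_of_le hp
  conv_lhs => rw [Lagrange.eq_interpolate (s := Finset.univ) (v := t) ht.injOn hdeg]
  rw [Lagrange.interpolate_apply, eval_finsetSum]
  simp [mul_comm]

variable {E : Type*} [NormedAddCommGroup E] [NormedSpace ℝ E] [FiniteDimensional ℝ E]

theorem ContinuousLinearMap.exists_polynomial_det_one_add_smul (A : E →L[ℝ] E) :
    ∃ p : ℝ[X], p.natDegree ≤ Module.finrank ℝ E ∧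
      ∀ s : ℝ, p.eval s = (ContinuousLinearMap.id ℝ E + s • A).det := by
  classical
  let b := Module.finBasis ℝ E
  let M := LinearMap.toMatrix b b (A : E →ₗ[ℝ] E)
  refine ⟨Matrix.det ((X : ℝ[X]) • M.map C + (1 : Matrix _ _ ℝ).map C), ?_, fun s => ?_⟩
  · simpa using Polynomial.natDegree_det_X_add_C_le M 1
  · rw [eval_det, ContinuousLinearMap.det, ← LinearMap.det_toMatrix b]
    congr 1
    ext i j
    simp [Matrix.one_apply, M, LinearMap.toMatrix_apply, add_comm]
    rw [Finsupp.single_apply, mul_comm s]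
    simp only [eq_comm]

/-- For `0 ≤ s ≤ t` the map `id + s • A` is injective, since `s • A` shrinks norms. So the
determinant has no zero on `[0, t]`, and it is one at zero. -/
theorem ContinuousLinearMap.det_id_add_smul_pos {A : E →L[ℝ] E} {K t : ℝ} (hK : ‖A‖ ≤ K)
    (ht : 0 ≤ t) (htK : t * K < 1) : 0 < (ContinuousLinearMap.id ℝ E + t • A).det := by
  obtain ⟨p, -, hp⟩ := A.exists_polynomial_det_one_add_smul
  have hne : ∀ s ∈ Icc 0 t, p.eval s ≠ 0 := by
    intro s hs h0
    rw [hp, ContinuousLinearMap.det] at h0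
    have hbot := LinearMap.bot_lt_ker_of_det_eq_zero h0
    obtain ⟨v, hv, hv0⟩ := (Submodule.ne_bot_iff _).1 hbot.ne'
    have hv' : v = -(s • A v) := by
      have : v + s • A v = 0 := hv
      exact eq_neg_of_add_eq_zero_left this
    have h1 : ‖v‖ ≤ s * (K * ‖v‖) := by
      conv_lhs => rw [hv', norm_neg, norm_smul, Real.norm_of_nonneg hs.1]
      gcongr
      · exact hs.1
      · exact (A.le_opNorm v).trans (by gcongr)
    have hvpos : 0 < ‖v‖ := norm_pos_iff.2 hv0
    have hK0 : 0 ≤ K := (norm_nonneg _).trans hK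
    have h2 : s * K ≤ t * K := by gcongr; exact hs.2
    nlinarith
  have h0 : p.eval 0 = 1 := by simp [hp, ContinuousLinearMap.det]
  rw [← hp]
  by_contra hneg
  push Not at hneg
  obtain ⟨s, hs, hs0⟩ := intermediate_value_Icc' ht (p.continuous.continuousOn)
    (show (0 : ℝ) ∈ Icc (p.eval t) (p.eval 0) from ⟨hneg, by rw [h0]; exact zero_le_one⟩)
  exact hne s hs hs0

/-- Inside the ball the derivative is bounded. A segment leaving the ball crosses the sphere, where
`ψ` vanishes, so extension by zero keeps the Lipschitz constant. -/
theorem exists_lipschitzWith_indicator_closedBall {ψ : E → E} (hψ : ContDiff ℝ 1 ψ) {ρ : ℝ}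
    (h0 : ∀ x, ‖x‖ = ρ → ψ x = 0) :
    ∃ K : NNReal, LipschitzWith K ((closedBall (0 : E) ρ).indicator ψ) := by
  obtain ⟨K, hK⟩ : ∃ K : NNReal, LipschitzOnWith K ψ (closedBall (0 : E) ρ) := by
    have hc : ContinuousOn (fun x => fderiv ℝ ψ x) (closedBall (0 : E) ρ) :=
      (hψ.continuous_fderiv one_ne_zero).continuousOn
    obtain ⟨C, hC⟩ := (isCompact_closedBall (0 : E) ρ).exists_bound_of_continuousOn hc
    refine ⟨C.toNNReal, Convex.lipschitzOnWith_of_nnnorm_fderiv_le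
      (fun x _ => (hψ.differentiable one_ne_zero).differentiableAt) (fun x hx => ?_)
      (convex_closedBall _ _)⟩
    rw [← NNReal.coe_le_coe, coe_nnnorm]
    exact (hC x hx).trans (Real.le_coe_toNNReal C)
  have key : ∀ x z, x ∈ closedBall (0 : E) ρ → z ∉ closedBall (0 : E) ρ →
      ‖ψ x‖ ≤ K * ‖x - z‖ := by
    intro x z hx hz
    rw [mem_closedBall_zero_iff] at hx hz
    push Not at hz
    have hcont : ContinuousOn (fun s : ℝ => ‖x + s • (z - x)‖) (Icc 0 1) := by fun_prop
    obtain ⟨s, hs, hsρ⟩ := intermediate_value_Icc zero_le_one hcont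
      (show ρ ∈ Icc _ _ by simpa using ⟨hx, hz.le⟩)
    simp only at hsρ
    have h1 := hK.dist_le_mul x (by simpa using hx) (x + s • (z - x)) (by simp [hsρ])
    rw [h0 _ hsρ, dist_zero_right] at h1
    refine h1.trans ?_
    gcongr
    rw [dist_eq_norm, sub_add_cancel_left, norm_neg, norm_smul, Real.norm_of_nonneg hs.1,
      norm_sub_rev x z]
    exact mul_le_of_le_one_left (norm_nonneg _) hs.2
  refine ⟨K, LipschitzWith.of_dist_le_mul fun x z => ?_⟩
  by_cases hx : x ∈ closedBall (0 : E) ρ <;> by_cases hz : z ∈ closedBall (0 : E) ρ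
  · simpa [indicator_of_mem hx, indicator_of_mem hz] using hK.dist_le_mul x hx z hz
  · rw [indicator_of_mem hx, indicator_of_notMem hz, dist_zero_right, dist_eq_norm]
    exact key x z hx hz
  · rw [indicator_of_notMem hx, indicator_of_mem hz, dist_zero_left, dist_comm, dist_eq_norm]
    exact key z x hz hx
  · rw [indicator_of_notMem hx, indicator_of_notMem hz, dist_self]
    positivity

/-- This is a perturbation of the identity by a map with Lipschitz constant less than one. -/
theorem bijective_add_smul_of_lipschitzWith [Nontrivial E] {φ : E → E} {K : NNReal}
    (hφ : LipschitzWith K φ) {t : ℝ} (ht : 0 ≤ t) (htK : t * K < 1) :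
    Function.Bijective fun x => x + t • φ x := by
  have happ : ApproximatesLinearOn (fun x => x + t • φ x)
      (ContinuousLinearEquiv.refl ℝ E : E →L[ℝ] E) univ (t.toNNReal * K) := by
    intro x _ y _
    have h : x + t • φ x - (y + t • φ y) - (x - y) = t • (φ x - φ y) := by
      rw [smul_sub]; abel
    simp only [ContinuousLinearEquiv.coe_refl, ContinuousLinearMap.coe_id', id_eq, h]
    rw [norm_smul, Real.norm_of_nonneg ht, NNReal.coe_mul, Real.coe_toNNReal _ ht, mul_assoc,
      ← dist_eq_norm, ← dist_eq_norm]
    gcongr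
    exact hφ.dist_le_mul x y
  have hc : Subsingleton E ∨
      t.toNNReal * K < ‖((ContinuousLinearEquiv.refl ℝ E).symm : E →L[ℝ] E)‖₊⁻¹ := by
    right
    have : ‖((ContinuousLinearEquiv.refl ℝ E).symm : E →L[ℝ] E)‖₊ = 1 := by
      ext; simp
    rw [this, inv_one, ← NNReal.coe_lt_coe, NNReal.coe_mul, Real.coe_toNNReal _ ht]
    exact htK
  exact (happ.toHomeomorph _ hc).bijective

variable [MeasurableSpace E] [BorelSpace E]

/-- The map `x + t • φ x` is a bijection fixing every point outside the open ball, so it maps the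
ball onto itself. Its Jacobian is positive there, and the change of variables formula gives the
volume. -/
theorem integral_det_id_add_smul_fderiv [Nontrivial E] (μ : Measure E) [μ.IsAddHaarMeasure]
    {ψ : E → E} (hψ : ContDiff ℝ 1 ψ) {ρ : ℝ} (h0 : ∀ x, ‖x‖ = ρ → ψ x = 0) {K : NNReal}
    (hK : LipschitzWith K ((closedBall (0 : E) ρ).indicator ψ)) {t : ℝ} (ht : 0 ≤ t)
    (htK : t * K < 1) :
    ∫ x in ball (0 : E) ρ, (ContinuousLinearMap.id ℝ E + t • fderiv ℝ ψ x).det ∂μ =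
      μ.real (ball (0 : E) ρ) := by
  set φ := (closedBall (0 : E) ρ).indicator ψ with hφ
  have hbij := bijective_add_smul_of_lipschitzWith hK ht htK
  set f : E → E := fun x => x + t • φ x with hf
  have hout : ∀ x, x ∉ ball (0 : E) ρ → f x = x := by
    intro x hx
    have : φ x = 0 := by
      by_cases hx' : x ∈ closedBall (0 : E) ρ
      · rw [hφ, indicator_of_mem hx']
        refine h0 x (le_antisymm (by simpa using hx') (by simpa using hx))
      · rw [hφ, indicator_of_notMem hx']
    simp [hf, this]
  have himage : f '' ball (0 : E) ρ = ball (0 : E) ρ := by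
    have hcompl : f '' (ball (0 : E) ρ)ᶜ = (ball (0 : E) ρ)ᶜ := by
      ext y
      constructor
      · rintro ⟨x, hx, rfl⟩
        rwa [hout x hx]
      · intro hy
        exact ⟨y, hy, hout y hy⟩
    have := image_compl_eq (s := ball (0 : E) ρ) hbij
    rw [hcompl] at this
    exact (compl_injective this).symm
  have hnear : ∀ x ∈ ball (0 : E) ρ, φ =ᶠ[nhds x] ψ := by
    intro x hx
    filter_upwards [isOpen_ball.mem_nhds hx] with y hy
    rw [hφ, indicator_of_mem (ball_subset_closedBall hy)]
  have hderivφ : ∀ x ∈ ball (0 : E) ρ, HasFDerivAt φ (fderiv ℝ ψ x) x := fun x hx =>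
    ((hψ.differentiable one_ne_zero).differentiableAt.hasFDerivAt).congr_of_eventuallyEq
      (hnear x hx)
  have hderiv : ∀ x ∈ ball (0 : E) ρ, HasFDerivWithinAt f
      (ContinuousLinearMap.id ℝ E + t • fderiv ℝ ψ x) (ball (0 : E) ρ) x := fun x hx =>
    ((hasFDerivAt_id x).add ((hderivφ x hx).const_smul t)).hasFDerivWithinAt
  have hpos : ∀ x ∈ ball (0 : E) ρ,
      0 < (ContinuousLinearMap.id ℝ E + t • fderiv ℝ ψ x).det := by
    intro x hx
    refine ContinuousLinearMap.det_id_add_smul_pos (K := K) ?_ ht htK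
    rw [← (hderivφ x hx).fderiv]
    exact norm_fderiv_le_of_lipschitz ℝ hK
  have := integral_image_eq_integral_abs_det_fderiv_smul μ measurableSet_ball hderiv
    hbij.injective.injOn (fun _ => (1 : ℝ))
  rw [himage, setIntegral_const] at this
  simp only [smul_eq_mul, mul_one] at this
  rw [this]
  refine setIntegral_congr_fun measurableSet_ball fun x hx => ?_
  simp only [abs_of_pos (hpos x hx)]

end NoRetraction

/-! ### Smooth retractions onto spheres, and contractions -/

section NotContractible

open MeasureTheory Metric Set

variable {E : Type*} [NormedAddCommGroup E] [InnerProductSpace ℝ E] [FiniteDimensional ℝ E]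
  [Nontrivial E]

/-- With `ψ = r - id`, the integral over the ball of `det (id + s • Dψ)` is the volume of the ball
for small `s ≥ 0`. The integrand is polynomial in `s`, so this persists at `s = 1`. There the
integrand is `det Dr`, which is zero because `r` takes values in a sphere. -/
theorem not_exists_contDiff_retraction {r : E → E} (hr : ContDiff ℝ 1 r) {ρ : ℝ} (hρ : 0 < ρ)
    (hnorm : ∀ x, ‖r x‖ = ρ) (hid : ∀ x, ‖x‖ = ρ → r x = x) : False := by
  let _ : MeasurableSpace E := borel E
  have : BorelSpace E := ⟨rfl⟩
  let μ : Measure E := Measure.addHaar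
  let ψ : E → E := fun x => r x - x
  have hψ : ContDiff ℝ 1 ψ := hr.sub contDiff_id
  have h0 : ∀ x, ‖x‖ = ρ → ψ x = 0 := fun x hx => by simp [ψ, hid x hx]
  obtain ⟨K, hK⟩ := exists_lipschitzWith_indicator_closedBall hψ h0
  let n := Module.finrank ℝ E
  -- These are `n + 1` distinct parameters, as many as interpolation in degree `n` needs, all small
  -- enough that `t i * K < 1`.
  let t : Fin (n + 1) → ℝ := fun i => ((i : ℕ) : ℝ) / (n + 1) / (K + 1)
  have htinj : Function.Injective t := by
    intro i j hij
    have h1 : (0 : ℝ) < n + 1 := by positivity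
    have h2 : (0 : ℝ) < K + 1 := by positivity
    simp only [t] at hij
    rw [div_left_inj' h2.ne', div_left_inj' h1.ne'] at hij
    exact Fin.ext (by exact_mod_cast hij)
  have ht0 : ∀ i, 0 ≤ t i := fun i => by positivity
  have htK : ∀ i, t i * K < 1 := by
    intro i
    have h1 : ((i : ℕ) : ℝ) / (n + 1) < 1 := by
      rw [div_lt_one (by positivity)]
      exact_mod_cast i.2
    have h2 : (0 : ℝ) ≤ ((i : ℕ) : ℝ) / (n + 1) := by positivity
    have h3 : (0 : ℝ) ≤ K := K.2
    simp only [t]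
    rw [div_mul_eq_mul_div, div_lt_one (by positivity)]
    nlinarith
  obtain ⟨c, hc⟩ := Polynomial.exists_weights_eval_one n t htinj
  let D : ℝ → E → ℝ := fun s x => (ContinuousLinearMap.id ℝ E + s • fderiv ℝ ψ x).det
  have hDcont : ∀ s, Continuous (D s) := fun s =>
    ContinuousLinearMap.continuous_det.comp
      (continuous_const.add ((hψ.continuous_fderiv one_ne_zero).const_smul s))
  have hint : ∀ s, IntegrableOn (D s) (ball (0 : E) ρ) μ := fun s =>
    ((hDcont s).continuousOn.integrableOn_compact (isCompact_closedBall (0 : E) ρ)).mono_set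
      ball_subset_closedBall
  have hsum : ∀ x, D 1 x = ∑ i, c i * D (t i) x := by
    intro x
    obtain ⟨p, hpdeg, hp⟩ := (fderiv ℝ ψ x).exists_polynomial_det_one_add_smul
    simp only [D, ← hp]
    exact hc p hpdeg
  have hc1 : ∑ i, c i = 1 := by
    simpa using (hc 1 (by simp)).symm
  have hvol : ∫ x in ball (0 : E) ρ, D 1 x ∂μ = μ.real (ball (0 : E) ρ) := by
    simp only [hsum]
    rw [integral_finsetSum _ fun i _ => (hint (t i)).const_mul (c i)]
    simp only [integral_const_mul]
    have : ∀ i, ∫ x in ball (0 : E) ρ, D (t i) x ∂μ = μ.real (ball (0 : E) ρ) := fun i =>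
      integral_det_id_add_smul_fderiv μ hψ h0 hK (ht0 i) (htK i)
    simp only [this]
    rw [← Finset.sum_mul, hc1, one_mul]
  have hzero : ∀ x, D 1 x = 0 := by
    intro x
    by_contra hne
    have hrd : HasFDerivAt r (fderiv ℝ r x) x :=
      (hr.differentiable one_ne_zero).differentiableAt.hasFDerivAt
    have hfd : ContinuousLinearMap.id ℝ E + (1 : ℝ) • fderiv ℝ ψ x = fderiv ℝ r x := by
      have : fderiv ℝ ψ x = fderiv ℝ r x - ContinuousLinearMap.id ℝ E :=
        (hrd.sub (hasFDerivAt_id x)).fderiv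
      rw [this, one_smul, add_sub_cancel]
    simp only [D, hfd, ContinuousLinearMap.det] at hne
    have hunit : IsUnit (fderiv ℝ r x : E →ₗ[ℝ] E) :=
      (LinearMap.isUnit_iff_isUnit_det _).2 (isUnit_iff_ne_zero.2 hne)
    have hsurj := LinearMap.range_eq_top.1 ((LinearMap.isUnit_iff_range_eq_top _).1 hunit)
    -- If `Dr` maps `v` to `r x`, then the derivative of the constant `‖r‖ ^ 2` along `v` is `2 * ρ
    -- ^ 2 ≠ 0`.
    obtain ⟨v, hv⟩ := hsurj (r x)
    have hconst : HasFDerivAt (fun y => ‖r y‖ ^ 2)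
        (2 • (innerSL ℝ (r x)).comp (fderiv ℝ r x)) x := hrd.norm_sq
    have hconst' : (fun y => ‖r y‖ ^ 2) = fun _ => ρ ^ 2 := by
      funext y; rw [hnorm]
    rw [hconst'] at hconst
    have heq := congrArg (fun A : E →L[ℝ] ℝ => A v)
      (hconst.unique (hasFDerivAt_const (ρ ^ 2) x))
    have hv' : fderiv ℝ r x v = r x := hv
    simp [hv', hnorm] at heq
    exact hρ.ne' heq
  have hμ : 0 < μ.real (ball (0 : E) ρ) :=
    ENNReal.toReal_pos (measure_ball_pos μ _ hρ).ne' measure_ball_lt_top.ne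
  simp only [hzero, integral_zero] at hvol
  exact hμ.ne hvol

/-- A unit sphere of a nonzero finite-dimensional inner product space is not contractible. -/
theorem not_contractibleSpace_sphere : ¬ ContractibleSpace (sphere (0 : E) 1) := by
  classical
  intro hcontr
  obtain ⟨p, ⟨H⟩⟩ := (contractible_iff_id_nullhomotopic _).1 hcontr
  let nrm : E → sphere (0 : E) 1 := fun x =>
    if h : x = 0 then p else ⟨‖x‖⁻¹ • x, by simp [norm_smul, h]⟩
  have hnrm : ∀ x, x ≠ 0 → (nrm x : E) = ‖x‖⁻¹ • x := fun x hx => by simp [nrm, hx]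
  -- The time is one for `‖x‖ ≤ 1/2` and zero for `‖x‖ ≥ 1`. So `f` is constant near the origin,
  -- where `nrm` is not continuous, and radial projection outside the unit ball.
  let τ : E → unitInterval := fun x => Set.projIcc 0 1 zero_le_one (2 - 2 * ‖x‖)
  let f : E → E := fun x => (H (τ x, nrm x) : E)
  have hτ : Continuous τ := continuous_projIcc.comp (by fun_prop)
  have hf1 : ∀ x, 1 ≤ ‖x‖ → f x = ‖x‖⁻¹ • x := by
    intro x hx
    have h0 : τ x = 0 := Set.projIcc_of_le_left _ (by linarith)
    have hx0 : x ≠ 0 := by rintro rfl; simp at hx; linarith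
    simp [f, h0, hnrm x hx0]
  have hf0 : ∀ x, ‖x‖ < 1 / 2 → f x = p := by
    intro x hx
    have h1 : τ x = 1 := Set.projIcc_of_right_le _ (by linarith)
    simp [f, h1]
  have hfnorm : ∀ x, ‖f x‖ = 1 := fun x => by simp [f]
  have hfc : Continuous f := by
    rw [continuous_iff_continuousAt]
    intro x
    by_cases hx : x = 0
    · have : f =ᶠ[nhds x] fun _ => (p : E) := by
        filter_upwards [isOpen_ball.mem_nhds (show x ∈ ball (0 : E) (1 / 2) by simp [hx])]
          with y hy
        exact hf0 y (by simpa using hy)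
      exact continuousAt_const.congr this.symm
    · have hc : ContinuousAt nrm x := by
        rw [Topology.IsInducing.subtypeVal.continuousAt_iff]
        have h2 : ContinuousAt (fun y : E => ‖y‖⁻¹ • y) x :=
          (continuous_norm.continuousAt.inv₀ (norm_ne_zero_iff.2 hx)).smul continuousAt_id
        refine h2.congr ?_
        filter_upwards [isOpen_ne.mem_nhds hx] with y hy
        exact (hnrm y hy).symm
      exact continuous_subtype_val.continuousAt.comp
        (H.continuous.continuousAt.comp (hτ.continuousAt.prodMk hc))
  have hfs : ContDiffOn ℝ 1 f {x : E | 1 < ‖x‖} := by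
    have : ContDiffOn ℝ 1 (fun x : E => ‖x‖⁻¹ • x) {x : E | 1 < ‖x‖} := by
      intro x hx
      have hx0 : x ≠ 0 := by rintro rfl; simp at hx; linarith
      exact (((contDiffAt_norm ℝ hx0).inv (norm_ne_zero_iff.2 hx0)).smul
        contDiffAt_id).contDiffWithinAt
    exact this.congr fun x hx => hf1 x (le_of_lt hx)
  have hopen : IsOpen {x : E | 1 < ‖x‖} := isOpen_lt continuous_const continuous_norm
  have hclosed : IsClosed {x : E | 2 ≤ ‖x‖} := isClosed_le continuous_const continuous_norm
  -- `f` is already smooth on `1 < ‖x‖`, so the approximation may agree with `f` on `2 ≤ ‖x‖`. Being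
  -- at distance less than one from unit vectors, `g` has no zero; normalised to length two it is a
  -- retraction onto the sphere of radius two.
  obtain ⟨g, hg, hgf, hgS, -⟩ := hfc.exists_contDiff_approx_and_eqOn 1
    (ε := fun _ => (1 : ℝ)) continuous_const (fun _ => one_pos) hclosed
    (hopen.mem_nhdsSet.2 fun x (hx : 2 ≤ ‖x‖) => lt_of_lt_of_le one_lt_two hx) hfs
  have hg0 : ∀ x, g x ≠ 0 := by
    intro x hx
    have := hgf x
    rw [hx, dist_zero_left, hfnorm] at this
    exact lt_irrefl _ this
  refine not_exists_contDiff_retraction (r := fun x => (2 : ℝ) • ‖g x‖⁻¹ • g x) (ρ := 2) ?_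
    two_pos (fun x => ?_) (fun x hx => ?_)
  · exact contDiff_const.smul (((hg.norm ℝ hg0).inv fun x => norm_ne_zero_iff.2 (hg0 x)).smul hg)
  · simp [norm_smul, hg0 x]
  · have hx2 : g x = ‖x‖⁻¹ • x := by
      rw [hgS (show 2 ≤ ‖x‖ from hx.ge), hf1 x (by linarith)]
    have hx1 : ‖g x‖ = 1 := by
      rw [hx2, norm_smul, hx]; norm_num
    simp only [hx1, inv_one, one_smul]
    rw [hx2, hx, smul_smul]
    norm_num

end NotContractible

theorem not_contractibleSpace_stdSphere (d : ℕ) : ¬ ContractibleSpace (StdSphere d) :=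
  not_contractibleSpace_sphere

/-! ### Order complexes of geometric lattices -/

section GeometricLattice

open Finset

/-- A rank function which exhibits a semilattice as a geometric lattice: elements of rank one are
the atoms, every element is a join of atoms, and joining an atom raises the rank by at most one. -/
structure IsGeometricRank {L : Type*} [SemilatticeSup L] [OrderBot L] (rk : L → ℕ) : Prop where
  strictMono : StrictMono rk
  bot : rk ⊥ = 0
  sup_atom_le : ∀ x a, rk a = 1 → rk (x ⊔ a) ≤ rk x + 1
  exists_atom : ∀ x y, x < y → ∃ a, rk a = 1 ∧ a ≤ y ∧ ¬ a ≤ x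

variable {L : Type*} [SemilatticeSup L] [OrderBot L] [Finite L] {rk : L → ℕ}

namespace IsGeometricRank

/-- Take `x` maximal among the elements below `W` that are not above `a`. If `x ⊔ a < W`, an atom `b
≤ W` not below `x ⊔ a` would give `x < x ⊔ a < x ⊔ b` by maximality, a jump of two in rank. So `x ⊔
a = W`. -/
theorem exists_coatom_not_ge (h : IsGeometricRank rk) {n : ℕ} {a W : L} (ha : rk a = 1)
    (haW : a ≤ W) (hW : rk W = n + 2) : ∃ x, x < W ∧ rk x = n + 1 ∧ ¬ a ≤ x := by
  have hne : {x | x ≤ W ∧ ¬ a ≤ x}.Nonempty := by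
    refine ⟨⊥, bot_le, fun hle => ?_⟩
    rw [le_bot_iff.1 hle, h.bot] at ha
    exact zero_ne_one ha
  obtain ⟨x, hx⟩ := (Set.toFinite {x | x ≤ W ∧ ¬ a ≤ x}).exists_maximal hne
  have hxW : x < W := lt_of_le_of_ne hx.prop.1 (by rintro rfl; exact hx.prop.2 haW)
  have hxa : x < x ⊔ a := left_lt_sup.2 hx.prop.2
  have hxa_rk : rk (x ⊔ a) = rk x + 1 :=
    le_antisymm (h.sup_atom_le x a ha) (h.strictMono hxa)
  have htop : x ⊔ a = W := by
    by_contra hne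
    obtain ⟨b, hb, hbW, hbx⟩ := h.exists_atom _ _ (lt_of_le_of_ne (sup_le hxW.le haW) hne)
    have hxb : x < x ⊔ b := left_lt_sup.2 fun hle => hbx (hle.trans le_sup_left)
    have haxb : a ≤ x ⊔ b := by
      by_contra hab
      exact hxb.not_ge (hx.le_of_ge ⟨sup_le hxW.le hbW, hab⟩ hxb.le)
    have hle : x ⊔ a ≤ x ⊔ b := sup_le le_sup_left haxb
    rcases hle.eq_or_lt with heq | hlt
    · exact hbx (heq ▸ le_sup_right)
    · have := h.strictMono hlt
      have := h.sup_atom_le x b hb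
      omega
  refine ⟨x, hxW, ?_, hx.prop.2⟩
  rw [htop] at hxa_rk
  omega

variable [DecidableEq L]

/-- The order complex of the open interval below an element of rank `n + 1` of a geometric lattice
becomes collapsible after the removal of a nonempty set of maximal chains. -/
theorem exists_collapsible_sdiff (h : IsGeometricRank rk) (n : ℕ) :
    ∀ W : L, rk W = n + 1 → ∃ Φ : Set (Finset L), Φ.Nonempty ∧ Φ ⊆ chainsIn (Set.Ioo ⊥ W) ∧
      (∀ φ ∈ Φ, #φ = n) ∧ Collapsible (chainsIn (Set.Ioo ⊥ W) \ Φ) := by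
  induction n with
  | zero =>
    intro W hW
    -- In rank one the only chain is the empty one; removing it leaves the family without faces.
    have hempty : Set.Ioo ⊥ W = (∅ : Set L) := by
      ext x
      simp only [Set.mem_Ioo, Set.mem_empty_iff_false, iff_false, not_and]
      intro h1 h2
      have := h.strictMono h1
      have := h.strictMono h2
      omega
    have hchain : chainsIn (Set.Ioo ⊥ W) = {∅} := by
      ext τ
      rw [hempty]
      simp only [chainsIn, Set.mem_ofPred_eq, Set.mem_singleton_iff, Set.subset_empty_iff,
        coe_eq_empty]
      constructor
      · exact fun h => h.1
      · rintro rfl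
        simp
    refine ⟨{∅}, Set.singleton_nonempty _, hchain.ge, by simp, ?_⟩
    rw [hchain, sdiff_self]
    exact .empty
  | succ n ih =>
    intro W hW
    have hbotW : ⊥ < W := bot_lt_iff_ne_bot.2 (by rintro rfl; rw [h.bot] at hW; omega)
    obtain ⟨a, ha, haW, -⟩ := h.exists_atom _ _ hbotW
    choose! Φ hΦne hΦsub hΦcard hΦcoll using ih
    -- `A` consists of the coatoms below `W` that are not above the atom `a`.
    set A : Set L := {x | x < W ∧ rk x = n + 1 ∧ ¬ a ≤ x} with hA
    have hbot : ∀ x, 0 < rk x → ⊥ < x := fun x hx =>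
      bot_lt_iff_ne_bot.2 (by rintro rfl; rw [h.bot] at hx; omega)
    have hnot : ∀ x, rk x = n + 1 → ∀ ν ∈ chainsIn (Set.Ioo ⊥ x), x ∉ ν := fun x _ ν hν hxν =>
      lt_irrefl x (hν.1 hxν).2
    have hinsert : ∀ x ∈ A, ∀ ν ∈ chainsIn (Set.Ioo ⊥ x),
        insert x ν ∈ chainsIn (Set.Ioo ⊥ W) := by
      intro x hx ν hν
      refine insert_mem_chainsIn ⟨hbot x (by rw [hx.2.1]; omega), hx.1⟩
        ⟨fun y hy => ⟨(hν.1 hy).1, (hν.1 hy).2.trans hx.1⟩, hν.2⟩ fun y hy => ?_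
      exact Or.inl (hν.1 hy).2.le
    -- The removed chains are those which pass through some `x ∈ A` and below it are removed chains
    -- of the interval `(⊥, x)`.
    set Ψ : Set (Finset L) := {φ | ∃ x ∈ A, x ∈ φ ∧ φ.erase x ∈ Φ x} with hΨ
    refine ⟨Ψ, ?_, ?_, ?_, ?_⟩
    · obtain ⟨x, hxW, hx, hax⟩ := h.exists_coatom_not_ge ha haW hW
      obtain ⟨ν, hν⟩ := hΦne x hx
      refine ⟨insert x ν, x, ⟨hxW, hx, hax⟩, mem_insert_self _ _, ?_⟩
      rwa [erase_insert (hnot x hx ν (hΦsub x hx hν))]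
    · rintro φ ⟨x, hx, hxφ, hφ⟩
      rw [← insert_erase hxφ]
      exact hinsert x hx _ (hΦsub x hx.2.1 hφ)
    · rintro φ ⟨x, hx, hxφ, hφ⟩
      rw [← insert_erase hxφ, card_insert_of_notMem (notMem_erase _ _), hΦcard x hx.2.1 _ hφ]
    -- The coatoms in `A` are put back one at a time.
    · have key : ∀ A' : Set L, A' ⊆ A →
          Collapsible {τ ∈ chainsIn (Set.Ioo ⊥ W) \ Ψ | ∀ x ∈ A, x ∈ τ → x ∈ A'} := by
        intro A'
        induction A', Set.toFinite A' using Set.Finite.induction_on with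
        | empty =>
          intro _
          have heq : {τ ∈ chainsIn (Set.Ioo ⊥ W) \ Ψ | ∀ x ∈ A, x ∈ τ → x ∈ (∅ : Set L)} =
              chainsIn (Set.Ioo ⊥ W \ A) := by
            ext τ
            simp only [Set.mem_ofPred_eq, Set.mem_empty_iff_false, chainsIn, Set.mem_sdiff]
            constructor
            · rintro ⟨⟨⟨h1, h2⟩, _⟩, h3⟩
              exact ⟨fun x hx => ⟨h1 hx, fun hxA => h3 x hxA hx⟩, h2⟩
            · rintro ⟨h1, h2⟩
              refine ⟨⟨⟨fun x hx => (h1 hx).1, h2⟩, ?_⟩, fun x hxA hx => (h1 hx).2 hxA⟩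
              rintro ⟨x, hxA, hx, _⟩
              exact (h1 hx).2 hxA
          rw [heq]
          -- Without `A`, joining with `a` never reaches `W`: if `x < W` and `x ⊔ a = W`, then `x`
          -- has rank `n + 1` and belongs to `A`. The closed elements all lie above `a`, so they
          -- form a cone.
          refine (collapsesTo_chainsIn_closed (c := fun x => x ⊔ a) ?_
            (fun x _ => le_sup_left) (fun x _ y _ hxy => sup_le_sup_right hxy a)
            (fun x _ => by simp)).collapsible (collapsible_of_isDominated_empty (v := a)
              (isDominated_chainsIn_empty ⟨⟨⟨hbot a (by omega), ?_⟩, ?_⟩, ?_⟩ ?_))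
          · rintro x ⟨⟨hx0, hxW⟩, hxA⟩
            refine ⟨⟨hx0.trans_le le_sup_left, lt_of_le_of_ne (sup_le hxW.le haW) ?_⟩, ?_⟩
            · intro htop
              have h1 := h.sup_atom_le x a ha
              have h2 := h.strictMono hxW
              rw [htop] at h1
              refine hxA ⟨hxW, by omega, fun hax => ?_⟩
              rw [sup_eq_left.2 hax] at htop
              exact hxW.ne htop
            · exact fun hx => hx.2.2 le_sup_right
          · refine lt_of_le_of_ne haW ?_
            rintro rfl
            omega
          · exact fun hx => hx.2.2 le_rfl
          · simp
          · rintro y ⟨_, hy⟩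
            exact Or.inr (sup_eq_left.1 hy)
        | @insert x A' hxA' _ ihA =>
          intro hsub
          have hx : x ∈ A := hsub (Set.mem_insert _ _)
          -- Elements of `A` have equal rank, so a chain contains at most one of them. Hence the
          -- link of `x` is the chain complex of `(⊥, x)` without `Φ x`, collapsible by induction.
          refine (hΦcoll x hx.2.1).of_link (x := x)
            (fun τ hτ => hnot x hx.2.1 τ hτ.1) (fun τ hxτ => ?_) ?_
          · constructor
            · rintro ⟨⟨⟨h1, h2⟩, h3⟩, _⟩
              refine ⟨⟨fun y hy => ?_, h2.mono (coe_subset.2 (erase_subset _ _))⟩,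
                fun hmem => h3 ⟨x, hx, hxτ, hmem⟩⟩
              obtain ⟨hyx, hyτ⟩ := mem_erase.1 hy
              refine ⟨(h1 hyτ).1, ?_⟩
              rcases h2.total hyτ hxτ with hle | hle
              · exact lt_of_le_of_ne hle hyx
              · have h4 := h.strictMono (lt_of_le_of_ne hle hyx.symm)
                have h5 := h.strictMono (h1 hyτ).2
                have h6 := hx.2.1
                omega
            · rintro ⟨h1, h2⟩
              have huniq : ∀ y ∈ A, y ∈ τ → y = x := by
                intro y hy hyτ
                by_contra hyx
                have h3 := h.strictMono (h1.1 (mem_erase.2 ⟨hyx, hyτ⟩)).2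
                rw [hx.2.1, hy.2.1] at h3
                exact lt_irrefl _ h3
              refine ⟨⟨?_, ?_⟩, fun y hy hyτ => Or.inl (huniq y hy hyτ)⟩
              · rw [← insert_erase hxτ]
                exact hinsert x hx _ h1
              · rintro ⟨y, hy, hyτ, hmem⟩
                rw [huniq y hy hyτ] at hmem
                exact h2 hmem
          · convert ihA ((Set.subset_insert _ _).trans hsub) using 1
            ext τ
            simp only [Set.mem_ofPred_eq, Set.mem_insert_iff]
            constructor
            · rintro ⟨⟨h1, h2⟩, h3⟩
              exact ⟨h1, fun y hy hyτ => (h2 y hy hyτ).resolve_left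
                (by rintro rfl; exact h3 hyτ)⟩
            · rintro ⟨h1, h2⟩
              exact ⟨⟨h1, fun y hy hyτ => Or.inr (h2 y hy hyτ)⟩, fun hxτ => hxA' (h2 x hx hxτ)⟩
      convert key A subset_rfl using 1
      ext τ
      simp only [Set.mem_ofPred_eq]
      exact ⟨fun hτ => ⟨hτ, fun x hx _ => hx⟩, fun hτ => hτ.1⟩

omit [Finite L] in
-- The rank is injective on a chain, with values in `1, …, n`. Hence chains with `n` elements are
-- maximal faces.
theorem card_le_of_mem_chainsIn_Ioo (h : IsGeometricRank rk) {n : ℕ} {W : L}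
    (hW : rk W = n + 1) {τ : Finset L} (hτ : τ ∈ chainsIn (Set.Ioo ⊥ W)) : #τ ≤ n := by
  have hinj : Set.InjOn rk τ := by
    intro x hx y hy hxy
    by_contra hne
    rcases hτ.2.total hx hy with hle | hle
    · exact (h.strictMono (lt_of_le_of_ne hle hne)).ne hxy
    · exact (h.strictMono (lt_of_le_of_ne hle (Ne.symm hne))).ne hxy.symm
  have hsub : τ.image rk ⊆ Finset.Ioo 0 (n + 1) := by
    intro m hm
    obtain ⟨x, hx, rfl⟩ := mem_image.1 hm
    rw [Finset.mem_Ioo, ← h.bot, ← hW]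
    exact ⟨h.strictMono (hτ.1 hx).1, h.strictMono (hτ.1 hx).2⟩
  have := card_le_card hsub
  rwa [card_image_of_injOn hinj, Nat.card_Ioo, Nat.sub_zero, Nat.add_sub_cancel] at this

end IsGeometricRank

end GeometricLattice

/-! ### Cochains and the fundamental group of a graph -/

namespace CWGraph

variable {V : Type*} {E : Type*} (G : CWGraph V E)

/-- A vertex as an object of the free groupoid. -/
abbrev ob (v : V) : Quiver.FreeGroupoid G.Vertex := (Quiver.FreeGroupoid.of G.Vertex).obj v

/-- An edge as a morphism of the free groupoid. -/
def edgeHom (e : E) : G.ob (G.src e) ⟶ G.ob (G.tgt e) :=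
  (Quiver.FreeGroupoid.of G.Vertex).map (X := G.src e) (Y := G.tgt e) ⟨e, rfl, rfl⟩

variable {G}

/-- Morphisms of the free groupoid are classes of paths whose steps are edges or reversed edges. -/
theorem hom_induction {P : ∀ u v : V, (G.ob u ⟶ G.ob v) → Prop} (id : ∀ u, P u u (𝟙 _))
    (comp : ∀ u v w p q, P u v p → P v w q → P u w (p ≫ q))
    (edge : ∀ e, P _ _ (G.edgeHom e)) (inv : ∀ u v p, P u v p → P v u (Groupoid.inv p)) :
    ∀ u v p, P u v p := by
  intro u v p
  induction p using Quot.ind with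
  | mk p =>
    change Quiver.Path (V := Quiver.Symmetrify G.Vertex) u v at p
    induction p with
    | nil => exact id u
    | @cons b c p f ih =>
      refine comp u b c (Quot.mk _ p) (Quot.mk _ (Quiver.Hom.toPath f)) ih ?_
      rcases f with ⟨e, h1, h2⟩ | ⟨e, h1, h2⟩
      · subst h1 h2
        exact edge e
      · subst h1 h2
        exact inv _ _ _ (edge e)

variable (G) in
/-- A functor from the free groupoid of `G` to a group. -/
structure Transport (Γ : Type*) [Group Γ] where
  /-- the value on morphisms -/
  val : ∀ {u v : V}, (G.ob u ⟶ G.ob v) → Γ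
  map_comp : ∀ {u v w : V} (p : G.ob u ⟶ G.ob v) (q : G.ob v ⟶ G.ob w),
    val (p ≫ q) = val p * val q

namespace Transport

variable {Γ : Type*} [Group Γ]

theorem map_id (T : G.Transport Γ) (u : V) : T.val (𝟙 (G.ob u)) = 1 := by
  have := T.map_comp (𝟙 (G.ob u)) (𝟙 (G.ob u))
  rw [Category.comp_id] at this
  exact left_eq_mul.1 this

theorem map_inv (T : G.Transport Γ) {u v : V} (p : G.ob u ⟶ G.ob v) :
    T.val (Groupoid.inv p) = (T.val p)⁻¹ := by
  rw [eq_inv_iff_mul_eq_one, ← T.map_comp, Groupoid.inv_comp, T.map_id]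

theorem eq_of_edgeHom {T T' : G.Transport Γ}
    (h : ∀ e, T.val (G.edgeHom e) = T'.val (G.edgeHom e)) {u v : V} (p : G.ob u ⟶ G.ob v) :
    T.val p = T'.val p := by
  refine hom_induction (P := fun u v p => T.val p = T'.val p) (fun u => ?_)
    (fun u v w p q hp hq => ?_) h (fun u v p hp => ?_) u v p
  · rw [T.map_id, T'.map_id]
  · rw [T.map_comp, T'.map_comp, hp, hq]
  · rw [T.map_inv, T'.map_inv, hp]

/-- The transport given by differences of a function on the vertices. -/
def ofVertices (f : V → Γ) : G.Transport Γ where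
  val {u v} _ := (f u)⁻¹ * f v
  map_comp p q := by group

variable (G) in
theorem exists_edgeHom_eq (c : E → Γ) : ∃ T : G.Transport Γ, ∀ e, T.val (G.edgeHom e) = c e := by
  -- Composition in a one-object category multiplies in reverse order; the opposite group undoes
  -- this.
  let φ : G.Vertex ⥤q SingleObj Γᵐᵒᵖ :=
    { obj := fun _ => SingleObj.star _
      map := fun e => MulOpposite.op (c e.1) }
  let Ψ := Quiver.FreeGroupoid.lift φ
  refine ⟨⟨fun {u v} p => MulOpposite.unop (α := Γ) (Ψ.map p), fun p q => ?_⟩, fun e => ?_⟩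
  · rw [Ψ.map_comp]
    rfl
  · have h := Quiver.FreeGroupoid.lift_spec φ
    have h2 := Prefunctor.congr_hom h (X := G.src e) (Y := G.tgt e) ⟨e, rfl, rfl⟩
    exact congrArg (MulOpposite.unop (α := Γ)) h2

open Classical in
/-- Closes up paths in the component of `v` to loops at `v`. -/
noncomputable def loop (v : V) : G.Transport (G.FundGroup v) where
  val {x y} p := if h : Nonempty (G.ob v ⟶ G.ob x) then
    h.some ≫ p ≫ Groupoid.inv (Nonempty.map (· ≫ p) h).some else 𝟙 _
  map_comp {x y z} p q := by
    by_cases h : Nonempty (G.ob v ⟶ G.ob x)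
    -- The path chosen from `v` to a vertex depends only on that vertex, so the two middle paths
    -- cancel.
    · have h' : Nonempty (G.ob v ⟶ G.ob y) := h.map (· ≫ p)
      rw [dif_pos h, dif_pos h, dif_pos h']
      change _ = _ ≫ _
      simp
    · have h' : ¬ Nonempty (G.ob v ⟶ G.ob y) := fun h' => h (h'.map (· ≫ Groupoid.inv p))
      rw [dif_neg h, dif_neg h, dif_neg h']
      exact (Category.comp_id _).symm

/-- The path chosen from `v` to itself need not be the identity, which accounts for the conjugation.
-/
theorem exists_loop_val_eq (v : V) : ∃ g : G.FundGroup v, ∀ p : G.FundGroup v,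
    (loop v).val p = g * p * g⁻¹ := by
  have h : Nonempty (G.ob v ⟶ G.ob v) := ⟨𝟙 _⟩
  refine ⟨h.some, fun p => ?_⟩
  unfold loop
  simp only [dif_pos h]
  exact (Category.assoc _ _ _).symm

/-- The quotient of two transports with values in a commutative group. -/
def div {M : Type*} [CommGroup M] (T T' : G.Transport M) : G.Transport M where
  val p := T.val p / T'.val p
  map_comp p q := by rw [T.map_comp, T'.map_comp, mul_div_mul_comm]

/-- The composition of a transport with a homomorphism. -/
def map {Γ' : Type*} [Group Γ'] (ψ : Γ →* Γ') (T : G.Transport Γ) : G.Transport Γ' where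
  val p := ψ (T.val p)
  map_comp p q := by rw [T.map_comp, _root_.map_mul]

end Transport

theorem Joined.nonempty_hom {u v : V} (h : G.Joined u v) : Nonempty (G.ob u ⟶ G.ob v) := by
  induction h with
  | rel u v h =>
    obtain ⟨e, rfl, rfl⟩ := h
    exact ⟨G.edgeHom e⟩
  | refl u => exact ⟨𝟙 _⟩
  | symm u v _ ih => exact ih.map fun p => Groupoid.inv p
  | trans u v w _ _ ih₁ ih₂ => exact ⟨ih₁.some ≫ ih₂.some⟩

theorem Joined.eq_of_forall_edge {X : Type*} {f : V → X} (hf : ∀ e, f (G.src e) = f (G.tgt e))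
    {u v : V} (h : G.Joined u v) : f u = f v := by
  induction h with
  | rel u v h =>
    obtain ⟨e, rfl, rfl⟩ := h
    exact hf e
  | refl u => rfl
  | symm u v _ ih => exact ih.symm
  | trans u v w _ _ ih₁ ih₂ => exact ih₁.trans ih₂

theorem joined_src_tgt (e : E) : G.Joined (G.src e) (G.tgt e) := .rel _ _ ⟨e, rfl, rfl⟩

/-- If all cochains modulo two are coboundaries, then so are all cochains with values in any
group. -/
theorem exists_coboundary_of_zmod_two [Finite E]
    (h : ∀ c : E → ZMod 2, ∃ f : V → ZMod 2, ∀ e, f (G.tgt e) - f (G.src e) = c e)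
    {Γ : Type*} [Group Γ] (c : E → Γ) : ∃ f : V → Γ, ∀ e, c e = (f (G.src e))⁻¹ * f (G.tgt e) := by
  classical
  have := Fintype.ofFinite E
  suffices ∀ S : Finset E, ∃ f : V → Γ, ∀ e ∈ S, c e = (f (G.src e))⁻¹ * f (G.tgt e) by
    obtain ⟨f, hf⟩ := this Finset.univ
    exact ⟨f, fun e => hf e (Finset.mem_univ e)⟩
  intro S
  induction S using Finset.induction_on with
  | empty => exact ⟨fun _ => 1, by simp⟩
  | insert e S heS ih =>
    obtain ⟨f, hf⟩ := ih
    -- `χ` is a cut that jumps only across `e`. Multiplying `f` from the left by a constant on one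
    -- side of the cut corrects the value at `e`; at every other edge both ends lie on the same side
    -- and the constant cancels.
    obtain ⟨χ, hχ⟩ := h (Pi.single e 1)
    have hχe : χ (G.tgt e) - χ (G.src e) = 1 := by simpa using hχ e
    have key : ∀ γ : Γ, ∀ e' ∈ S, c e' =
        ((if χ (G.src e') = 1 then γ * f (G.src e') else f (G.src e')))⁻¹ *
          (if χ (G.tgt e') = 1 then γ * f (G.tgt e') else f (G.tgt e')) := by
      intro γ e' he'
      have hne : e' ≠ e := by rintro rfl; exact heS he'
      have heq : χ (G.tgt e') = χ (G.src e') := sub_eq_zero.1 (by simpa [hne] using hχ e')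
      rw [heq, hf e' he']
      split_ifs <;> group
    have h01 : ∀ a : ZMod 2, a = 0 ∨ a = 1 := by decide
    rcases h01 (χ (G.src e)) with h0 | h1
    · have h1 : χ (G.tgt e) = 1 := by rw [h0, sub_zero] at hχe; exact hχe
      refine ⟨fun x => if χ x = 1 then f (G.src e) * c e * (f (G.tgt e))⁻¹ * f x else f x,
        fun e' he' => ?_⟩
      rcases Finset.mem_insert.1 he' with rfl | he'
      · simp [h0, h1, mul_assoc]
      · exact key _ e' he'
    · have h0 : χ (G.tgt e) = 0 := by
        rw [h1] at hχe
        revert hχe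
        generalize χ (G.tgt e) = a
        revert a
        decide
      refine ⟨fun x => if χ x = 1 then f (G.tgt e) * (c e)⁻¹ * (f (G.src e))⁻¹ * f x else f x,
        fun e' he' => ?_⟩
      rcases Finset.mem_insert.1 he' with rfl | he'
      · simp [h0, h1, mul_assoc]
      · exact key _ e' he'

/-- All components are trees with at most one label if and only if every cochain modulo two is the
coboundary of a function that vanishes on the labels. -/
theorem not_hasBigComponent_iff [Finite E] (l : Set V) : ¬ G.HasBigComponent l ↔
    ∀ c : E → ZMod 2, ∃ f : V → ZMod 2, (∀ v ∈ l, f v = 0) ∧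
      ∀ e, f (G.tgt e) - f (G.src e) = c e := by
  classical
  constructor
  · intro hbig c
    unfold HasBigComponent at hbig
    push Not at hbig
    -- `ρ` selects a root in each component, the labelled vertex if there is one. It depends only on
    -- the component as a set.
    let ρ : V → V := fun x => if h : (l ∩ G.component x).Nonempty then h.some else
      (show (G.component x).Nonempty from ⟨x, .refl x⟩).some
    have hρ : ∀ x, G.Joined (ρ x) x := by
      intro x
      simp only [ρ]
      split_ifs with h
      · exact .symm _ _ h.some_mem.2
      · exact .symm _ _ (Set.Nonempty.some_mem (s := G.component x) _)
    have hρl : ∀ x ∈ l, ρ x = x := by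
      intro x hx
      have h : (l ∩ G.component x).Nonempty := ⟨x, hx, .refl x⟩
      simp only [ρ, dif_pos h]
      exact Set.not_nontrivial_iff.1 (Set.not_nontrivial_iff.2 (hbig x).2) h.some_mem
        ⟨hx, .refl x⟩
    have hρe : ∀ e, ρ (G.tgt e) = ρ (G.src e) := by
      intro e
      have : G.component (G.tgt e) = G.component (G.src e) := by
        ext w
        exact ⟨fun h => .trans _ _ _ (joined_src_tgt e) h,
          fun h => .trans _ _ _ (.symm _ _ (joined_src_tgt e)) h⟩
      simp only [ρ, this]
    -- Sum the cochain along paths from the root. Trivial fundamental groups make the result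
    -- independent of the path, and a label, being its own root, gets the value zero.
    obtain ⟨T, hT⟩ := Transport.exists_edgeHom_eq G (fun e => Multiplicative.ofAdd (c e))
    have huniq : ∀ {r x : V} (p q : G.ob r ⟶ G.ob x), T.val p = T.val q := by
      intro r x p q
      have hsub : Subsingleton (G.FundGroup r) := not_nontrivial_iff_subsingleton.1 (by
        exact not_nontrivial_iff_subsingleton.2 (hbig r).1)
      have : (p ≫ Groupoid.inv q : G.FundGroup r) = 𝟙 _ := hsub.elim _ _
      have h2 := congrArg T.val this
      rw [T.map_comp, T.map_inv, T.map_id] at h2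
      exact mul_inv_eq_one.1 h2
    have hex : ∀ x, ∃ a, ∀ p : G.ob (ρ x) ⟶ G.ob x, T.val p = a := by
      intro x
      obtain ⟨p⟩ := (hρ x).nonempty_hom
      exact ⟨T.val p, fun q => huniq q p⟩
    choose f hf using hex
    refine ⟨fun x => (f x).toAdd, fun x hx => ?_, fun e => ?_⟩
    · have h := hf x
      rw [hρl x hx] at h
      change (f x).toAdd = 0
      rw [← h (𝟙 _), T.map_id]
      rfl
    · obtain ⟨p⟩ := (hρ (G.src e)).nonempty_hom
      have h := hf (G.tgt e)
      rw [hρe e] at h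
      change (f (G.tgt e)).toAdd - (f (G.src e)).toAdd = c e
      rw [← h (p ≫ G.edgeHom e), T.map_comp, ← hf _ p, hT]
      simp
  · rintro h ⟨v, hv | ⟨x, ⟨hxl, hx⟩, y, ⟨hyl, hy⟩, hxy⟩⟩
    -- The closing-up transport is a coboundary with values in the fundamental group. A coboundary
    -- is trivial on loops, whereas this transport is a conjugation there.
    · obtain ⟨g, hg⟩ := Transport.exists_loop_val_eq (G := G) v
      obtain ⟨f, hf⟩ := exists_coboundary_of_zmod_two (fun c => (h c).imp fun f hf => hf.2)
        fun e => (Transport.loop (G := G) v).val (G.edgeHom e)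
      obtain ⟨p, hp⟩ := exists_ne (1 : G.FundGroup v)
      have h1 : (Transport.loop v).val p = 1 := by
        rw [Transport.eq_of_edgeHom (T' := .ofVertices f) hf p]
        exact inv_mul_cancel _
      rw [hg, conj_eq_one_iff] at h1
      exact hp h1
    -- For the coboundary of the indicator of the label `y`, the difference of `f` and the indicator
    -- is constant on the component; but it is zero at `x` and nonzero at `y`.
    · obtain ⟨f, hfl, hf⟩ := h fun e =>
        (Pi.single y 1 : V → ZMod 2) (G.tgt e) - (Pi.single y 1 : V → ZMod 2) (G.src e)
      have hxy' : G.Joined x y := .trans _ _ _ (.symm _ _ hx) hy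
      have := hxy'.eq_of_forall_edge (f := fun w => f w - (Pi.single y 1 : V → ZMod 2) w)
        fun e => by linear_combination - hf e
      simp [hfl x hxl, hfl y hyl, hxy] at this

/-! ### The coboundary map modulo two -/

variable (G) in
/-- The coboundary of functions modulo two. -/
def coboundary : (V → ZMod 2) →ₗ[ZMod 2] (E → ZMod 2) where
  toFun f e := f (G.tgt e) - f (G.src e)
  map_add' f g := by ext e; simp only [Pi.add_apply]; ring
  map_smul' a f := by ext e; simp only [Pi.smul_apply, smul_eq_mul, RingHom.id_apply]; ring

@[simp]
theorem coboundary_apply (f : V → ZMod 2) (e : E) :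
    G.coboundary f e = f (G.tgt e) - f (G.src e) := rfl

/-- The functions modulo two which vanish on `l`. -/
def vanishingOn (l : Set V) : Submodule (ZMod 2) (V → ZMod 2) :=
  LinearMap.ker (LinearMap.funLeft (ZMod 2) (ZMod 2) (Subtype.val : l → V))

@[simp]
theorem mem_vanishingOn {l : Set V} {f : V → ZMod 2} :
    f ∈ vanishingOn l ↔ ∀ v ∈ l, f v = 0 := by
  rw [vanishingOn, LinearMap.mem_ker, funext_iff]
  simp [LinearMap.funLeft_apply]

/-! ### Dimension of the relative cohomology -/

variable (G) in
/-- The first cohomology modulo two of `G` relative to `l`. -/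
abbrev RelCohomology (l : Set V) : Type _ :=
  (E → ZMod 2) ⧸ (vanishingOn l).map G.coboundary

theorem coboundary_eq_zero_iff (hconn : G.IsConnected) {f : V → ZMod 2} :
    G.coboundary f = 0 ↔ ∀ u v, f u = f v := by
  constructor
  · intro h u v
    refine (hconn.2 u v).eq_of_forall_edge fun e => ?_
    exact (sub_eq_zero.1 (congrFun h e)).symm
  · intro h
    ext e
    exact sub_eq_zero.2 (h _ _)

/-- On a connected graph the kernel of the coboundary is the line of constant functions. -/
theorem finrank_range_coboundary [Finite V] (hconn : G.IsConnected) :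
    Module.finrank (ZMod 2) (LinearMap.range G.coboundary) + 1 = Nat.card V := by
  have := Fintype.ofFinite V
  have h := G.coboundary.finrank_range_add_finrank_ker
  have hker : LinearMap.ker G.coboundary = Submodule.span (ZMod 2) {fun _ => 1} := by
    ext f
    rw [LinearMap.mem_ker, coboundary_eq_zero_iff hconn, Submodule.mem_span_singleton]
    constructor
    · intro hf
      obtain ⟨v⟩ := hconn.1
      exact ⟨f v, funext fun w => by simp [hf v w]⟩
    · rintro ⟨a, rfl⟩ u v
      rfl
  rw [hker, finrank_span_singleton, Module.finrank_pi, Fintype.card_eq_nat_card] at h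
  · exact h
  · obtain ⟨v⟩ := hconn.1
    exact fun h => one_ne_zero (congrFun h v)

/-- A constant function that vanishes at a label is zero, so the coboundary is injective on
functions vanishing on `l`. -/
theorem finrank_map_vanishingOn [Finite V] (hconn : G.IsConnected) {l : Set V}
    (hl : l.Nonempty) :
    Module.finrank (ZMod 2) ((vanishingOn l).map G.coboundary) + l.ncard = Nat.card V := by
  have := Fintype.ofFinite V
  have hinj : Function.Injective (G.coboundary.domRestrict (vanishingOn l)) := by
    rw [← LinearMap.ker_eq_bot, Submodule.eq_bot_iff]
    rintro ⟨f, hf⟩ hf0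
    have hconst := (coboundary_eq_zero_iff hconn).1 (LinearMap.mem_ker.1 hf0)
    obtain ⟨v, hv⟩ := hl
    refine Subtype.ext (funext fun w => ?_)
    exact (hconst w v).trans (mem_vanishingOn.1 hf v hv)
  have h1 : Module.finrank (ZMod 2) ((vanishingOn l).map G.coboundary) =
      Module.finrank (ZMod 2) (vanishingOn l) := by
    rw [← LinearMap.range_domRestrict]
    exact LinearMap.finrank_range_of_inj hinj
  have h2 := (LinearMap.funLeft (ZMod 2) (ZMod 2)
    (Subtype.val : l → V)).finrank_range_add_finrank_ker
  have := Fintype.ofFinite l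
  rw [LinearMap.range_eq_top.2 (LinearMap.funLeft_surjective_of_injective _ _ _
    Subtype.val_injective), finrank_top, Module.finrank_pi, Module.finrank_pi,
    Fintype.card_eq_nat_card, Fintype.card_eq_nat_card, Nat.card_coe_set_eq] at h2
  rw [h1, add_comm]
  exact h2

/-- The rank of the first cohomology is the rank of the fundamental group. -/
theorem finrank_quotient_range_coboundary [Finite E] (hconn : G.IsConnected) {n : ℕ}
    (hn : G.HasRank n) :
    Module.finrank (ZMod 2) ((E → ZMod 2) ⧸ LinearMap.range G.coboundary) = n := by
  obtain ⟨v, ⟨ε⟩⟩ := hn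
  choose T hT using Transport.exists_edgeHom_eq G (Γ := Multiplicative (ZMod 2))
  -- Evaluating cochains on loops induces the isomorphism from cohomology to `Hom(π₁, ℤ/2)`; the
  -- dimension is then found by counting elements.
  let Ψ : (E → ZMod 2) → (G.FundGroup v →* Multiplicative (ZMod 2)) := fun c =>
    MonoidHom.mk' (fun p => (T fun e => Multiplicative.ofAdd (c e)).val p)
      fun p q => Transport.map_comp _ p q
  have hΨ : ∀ c c', Ψ c = Ψ c' ↔ c - c' ∈ LinearMap.range G.coboundary := by
    intro c c'
    let D := (T fun e => Multiplicative.ofAdd (c e)).div (T fun e => Multiplicative.ofAdd (c' e))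
    have hD : ∀ e, D.val (G.edgeHom e) = Multiplicative.ofAdd (c e - c' e) := by
      intro e
      change (T _).val _ / (T _).val _ = _
      rw [hT, hT]
      rfl
    constructor
    · intro heq
      have hD1 : ∀ p : G.FundGroup v, D.val p = 1 := fun p =>
        div_eq_one.2 (DFunLike.congr_fun heq p)
      -- A potential is obtained by evaluating along a chosen path from `v` to each vertex.
      let g : ∀ x, G.ob v ⟶ G.ob x := fun x => (hconn.2 v x).nonempty_hom.some
      refine ⟨fun x => (D.val (g x)).toAdd, ?_⟩
      ext e
      have h1 := hD1 (g (G.src e) ≫ G.edgeHom e ≫ Groupoid.inv (g (G.tgt e)))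
      rw [D.map_comp, D.map_comp, D.map_inv, hD] at h1
      have h2 := congrArg Multiplicative.toAdd h1
      simp only [toAdd_mul, toAdd_inv, toAdd_ofAdd, toAdd_one] at h2
      simp only [coboundary_apply, Pi.sub_apply]
      linear_combination -h2
    · rintro ⟨f, hf⟩
      let φ : V → Multiplicative (ZMod 2) := fun x => Multiplicative.ofAdd (f x)
      have hD1 : ∀ p : G.FundGroup v, D.val p = 1 := by
        intro p
        rw [Transport.eq_of_edgeHom
          (T' := .ofVertices φ) (fun e => ?_) p]
        · exact inv_mul_cancel _
        · have := congrFun hf e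
          simp only [coboundary_apply, Pi.sub_apply] at this
          rw [hD, ← this]
          change _ = _ * _
          rw [← ofAdd_neg, ← ofAdd_add, neg_add_eq_sub]
      refine MonoidHom.ext fun p => ?_
      exact div_eq_one.1 (hD1 p)
  -- A homomorphism is lifted by evaluating it on the closed-up edges; the resulting conjugation is
  -- invisible in a commutative group.
  have hsurj : Function.Surjective Ψ := by
    intro ψ
    refine ⟨fun e => (ψ ((Transport.loop v).val (G.edgeHom e))).toAdd, ?_⟩
    refine MonoidHom.ext fun p => ?_
    have h1 := Transport.eq_of_edgeHom (G := G) (T := T fun e =>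
      Multiplicative.ofAdd (ψ ((Transport.loop v).val (G.edgeHom e))).toAdd)
      (T' := (Transport.loop v).map ψ) (fun e => (hT _ e).trans rfl) p
    refine h1.trans ?_
    obtain ⟨g, hg⟩ := Transport.exists_loop_val_eq (G := G) v
    change ψ ((Transport.loop v).val p) = ψ p
    rw [hg, map_mul, map_mul, map_inv, mul_right_comm, mul_inv_cancel, one_mul]
  let Ξ : ((E → ZMod 2) ⧸ LinearMap.range G.coboundary) →
      (G.FundGroup v →* Multiplicative (ZMod 2)) := fun x => Ψ x.out
  have hΞ : Function.Bijective Ξ := by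
    constructor
    · intro x y hxy
      rw [← Quotient.out_eq x, ← Quotient.out_eq y]
      exact (Submodule.Quotient.eq _).2 ((hΨ _ _).1 hxy)
    · intro ψ
      obtain ⟨c, rfl⟩ := hsurj ψ
      refine ⟨Submodule.Quotient.mk c, (hΨ _ _).2 ?_⟩
      rw [← Submodule.Quotient.eq]
      exact Quotient.out_eq _
  have hcard : Nat.card ((E → ZMod 2) ⧸ LinearMap.range G.coboundary) = 2 ^ n := by
    rw [Nat.card_congr (Equiv.ofBijective Ξ hΞ)]
    let e₁ : (G.FundGroup v →* Multiplicative (ZMod 2)) ≃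
        (FreeGroup (Fin n) →* Multiplicative (ZMod 2)) :=
      { toFun := fun ψ => ψ.comp ε.symm.toMonoidHom
        invFun := fun ψ => ψ.comp ε.toMonoidHom
        left_inv := fun ψ => by ext; simp
        right_inv := fun ψ => by ext; simp }
    rw [Nat.card_congr (e₁.trans FreeGroup.lift.symm), Nat.card_fun]
    simp
  have := Fintype.ofFinite E
  have h2 := Module.natCard_eq_pow_finrank (K := ZMod 2)
    (V := (E → ZMod 2) ⧸ LinearMap.range G.coboundary)
  rw [hcard, Nat.card_zmod] at h2
  exact (Nat.pow_right_injective le_rfl h2).symm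

/-- For `k ≥ 1` labels the coboundaries have dimension `|V| - k` instead of `|V| - 1`, which
enlarges the quotient by `k - 1`. -/
theorem finrank_relCohomology [Finite V] [Finite E] (hconn : G.IsConnected) {n : ℕ}
    (hn : G.HasRank n) (l : Set V) : Module.finrank (ZMod 2) (G.RelCohomology l) =
      if 1 ≤ l.ncard then n + l.ncard - 1 else n := by
  have h0 := finrank_quotient_range_coboundary hconn hn
  have := Fintype.ofFinite E
  split_ifs with hl
  · have hlne : l.Nonempty := (Set.ncard_pos (Set.toFinite l)).1 hl
    have h1 := finrank_map_vanishingOn hconn hlne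
    have h2 := finrank_range_coboundary hconn
    have h3 := Submodule.finrank_quotient_add_finrank (LinearMap.range G.coboundary)
    change Module.finrank (ZMod 2) ((E → ZMod 2) ⧸ (vanishingOn l).map G.coboundary) = _
    have h4 := Submodule.finrank_quotient_add_finrank ((vanishingOn l).map G.coboundary)
    omega
  · have hle : l = ∅ := by
      rw [← Set.ncard_eq_zero (Set.toFinite l)]
      omega
    have : vanishingOn l = ⊤ := by
      rw [hle, eq_top_iff]
      intro f _
      simp
    rw [← h0, ← Submodule.map_top, ← this]

/-! ### Edge classes, subgraphs and separating edges -/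

variable (G) in
/-- The class of an edge in the relative cohomology. -/
noncomputable def edgeClass (l : Set V) (e : E) : G.RelCohomology l := by
  classical exact Submodule.Quotient.mk (Pi.single e 1)

/-- The edges in `T` span the cochains supported on `T`. Their classes span the quotient exactly
when every cochain agrees off `T` with an admissible coboundary. -/
theorem span_edgeClass_eq_top_iff [Finite E] (l : Set V) (T : Set E) :
    Submodule.span (ZMod 2) (G.edgeClass l '' T) = ⊤ ↔
      ∀ c : E → ZMod 2, ∃ f : V → ZMod 2, (∀ v ∈ l, f v = 0) ∧
        ∀ e ∉ T, f (G.tgt e) - f (G.src e) = c e := by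
  classical
  have := Fintype.ofFinite E
  have hspan : ∀ c : E → ZMod 2,
      c ∈ Submodule.span (ZMod 2) ((fun e => (Pi.single e 1 : E → ZMod 2)) '' T) ↔
        ∀ e ∉ T, c e = 0 := by
    intro c
    constructor
    · intro hc e he
      induction hc using Submodule.span_induction with
      | mem x hx =>
        obtain ⟨e', he', rfl⟩ := hx
        exact Pi.single_eq_of_ne (by rintro rfl; exact he he') _
      | zero => rfl
      | add x y _ _ hx hy => simp [hx, hy]
      | smul a x _ hx => simp [hx]
    · intro hc
      rw [pi_eq_sum_univ' c]
      refine Submodule.sum_mem _ fun e _ => ?_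
      by_cases he : e ∈ T
      · refine Submodule.smul_mem _ _ (Submodule.subset_span ⟨e, he, ?_⟩)
        ext i
        simp [Pi.single_apply, eq_comm]
      · rw [hc e he, zero_smul]
        exact Submodule.zero_mem _
  have himage : G.edgeClass l '' T = ((vanishingOn l).map G.coboundary).mkQ ''
      ((fun e => (Pi.single e 1 : E → ZMod 2)) '' T) := by
    rw [Set.image_image]
    rfl
  rw [himage, ← Submodule.map_span, Submodule.map_mkQ_eq_top, Submodule.eq_top_iff']
  refine forall_congr' fun c => ?_
  rw [Submodule.mem_sup]
  constructor
  · rintro ⟨_, ⟨f, hf, rfl⟩, z, hz, rfl⟩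
    refine ⟨f, mem_vanishingOn.1 hf, fun e he => ?_⟩
    simp [(hspan z).1 hz e he]
  · rintro ⟨f, hfl, hf⟩
    refine ⟨G.coboundary f, ⟨f, mem_vanishingOn.2 hfl, rfl⟩, c - G.coboundary f,
      (hspan _).2 fun e he => ?_, by simp⟩
    simp [hf e he]

/-- A proper subgraph lies in `X(G, l)` if and only if the classes of the complementary edges do
not span the relative cohomology. -/
theorem mem_nonTrees_iff [Finite E] (l : Set V) (S : Set E) : S ∈ G.nonTrees l ↔
    Sᶜ.Nonempty ∧ Submodule.span (ZMod 2) (G.edgeClass l '' Sᶜ) ≠ ⊤ := by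
  classical
  refine and_congr ?_ ?_
  · rw [Set.nonempty_compl]
  · rw [Ne, span_edgeClass_eq_top_iff, ← not_iff_not, not_not, not_hasBigComponent_iff]
    constructor
    · intro h c
      obtain ⟨f, hfl, hf⟩ := h fun e => c e
      -- Vertices outside the subgraph meet no edge of `S`, so the value there is free; zero
      -- respects the condition on the labels.
      refine ⟨fun x => if hx : x ∈ G.verts S then f ⟨x, hx⟩ else 0, fun v hv => ?_,
        fun e he => ?_⟩
      · dsimp only
        split_ifs with hx
        · exact hfl ⟨v, hx⟩ hv
        · rfl
      · rw [Set.notMem_compl_iff] at he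
        have h1 : G.src e ∈ G.verts S := ⟨e, he, Or.inl rfl⟩
        have h2 : G.tgt e ∈ G.verts S := ⟨e, he, Or.inr rfl⟩
        simp only [dif_pos h1, dif_pos h2]
        exact hf ⟨e, he⟩
    · intro h c
      obtain ⟨f, hfl, hf⟩ := h fun e => if he : e ∈ S then c ⟨e, he⟩ else 0
      refine ⟨fun x => f x, fun v hv => hfl v hv, fun e => ?_⟩
      have := hf e (Set.notMem_compl_iff.2 e.2)
      rw [dif_pos e.2] at this
      exact this

theorem edgeClass_eq_zero_iff (l : Set V) (e : E) : G.edgeClass l e = 0 ↔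
    ∃ f : V → ZMod 2, (∀ v ∈ l, f v = 0) ∧ f (G.tgt e) - f (G.src e) = 1 ∧
      ∀ e' ≠ e, f (G.tgt e') = f (G.src e') := by
  classical
  have : G.edgeClass l e = Submodule.Quotient.mk (Pi.single e 1) := by
    unfold edgeClass
    congr!
  rw [this, Submodule.Quotient.mk_eq_zero, Submodule.mem_map]
  refine exists_congr fun f => and_congr mem_vanishingOn ?_
  constructor
  · intro h
    refine ⟨by simpa using congrFun h e, fun e' he' => ?_⟩
    exact sub_eq_zero.1 (by simpa [he'] using congrFun h e')
  · rintro ⟨h1, h2⟩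
    ext e'
    by_cases he : e' = e
    · subst he
      simpa using h1
    · simpa [he] using sub_eq_zero.2 (h2 e' he)

/-- A function whose coboundary is supported on `e` alone is the indicator of one side of `e`;
vanishing on `l` means that the labels lie on the other side. Given a zero class, `{e}` fails to
span exactly when the cohomology is nonzero. -/
theorem isLSeparating_iff [Finite E] (hconn : G.IsConnected) (l : Set V) (e : E) :
    G.IsLSeparating l e ↔
      G.edgeClass l e = 0 ∧ 0 < Module.finrank (ZMod 2) (G.RelCohomology l) := by
  classical
  have := Fintype.ofFinite E
  have hconst : ∀ {f : V → ZMod 2}, (∀ e' ≠ e, f (G.tgt e') = f (G.src e')) →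
      ∀ {x y}, (G.removeInterior e).Joined x y → f x = f y := fun hf _ _ hxy =>
    hxy.eq_of_forall_edge fun e' => (hf e'.1 e'.2).symm
  constructor
  · rintro ⟨hsep, ⟨v, hv⟩, hmem⟩
    refine ⟨(edgeClass_eq_zero_iff l e).2 ?_, ?_⟩
    · let f : V → ZMod 2 := fun x => if (G.removeInterior e).Joined v x then 0 else 1
      have hfe : ∀ e' ≠ e, f (G.tgt e') = f (G.src e') := by
        intro e' he'
        have hj : (G.removeInterior e).Joined (G.src e') (G.tgt e') :=
          joined_src_tgt (G := G.removeInterior e) ⟨e', he'⟩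
        have : (G.removeInterior e).Joined v (G.tgt e') ↔
            (G.removeInterior e).Joined v (G.src e') :=
          ⟨fun h => .trans _ _ _ h (.symm _ _ hj), fun h => .trans _ _ _ h hj⟩
        simp only [f, this]
      refine ⟨f, fun w hw => if_pos (hv hw), ?_, hfe⟩
      have hne : f (G.tgt e) - f (G.src e) ≠ 0 := by
        intro h0
        refine hsep ⟨hconn.1, fun x y => ?_⟩
        have hf0 : ∀ x, f x = 0 := by
          intro x
          have : f x = f v := (hconn.2 x v).eq_of_forall_edge fun e' => by
            by_cases he' : e' = e
            · rw [he']; exact (sub_eq_zero.1 h0).symm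
            · exact (hfe e' he').symm
          rw [this]
          exact if_pos (.refl v)
        have hjoin : ∀ x, (G.removeInterior e).Joined v x := by
          intro x
          by_contra hx
          have := hf0 x
          simp [f, hx] at this
        exact .trans _ _ _ (.symm _ _ (hjoin x)) (hjoin y)
      revert hne
      generalize f (G.tgt e) - f (G.src e) = a
      revert a
      decide
    · refine Nat.pos_of_ne_zero fun h0 => ((mem_nonTrees_iff l _).1 hmem).2 ?_
      have := Module.finrank_zero_iff.1 h0
      exact Subsingleton.elim _ _
  · rintro ⟨he, hpos⟩
    obtain ⟨f, hfl, hfe, hf⟩ := (edgeClass_eq_zero_iff l e).1 he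
    have hne : f (G.tgt e) ≠ f (G.src e) := fun h => by
      rw [h, sub_self] at hfe
      exact zero_ne_one hfe
    refine ⟨fun hc => hne (hconst hf (hc.2 _ _)), ?_, ?_⟩
    -- Without `e` there are at most two components, one for each end, and `f` distinguishes the
    -- ends. So all labels, having value zero, lie in one component.
    · have hends : ∀ x, (G.removeInterior e).Joined (G.src e) x ∨
          (G.removeInterior e).Joined (G.tgt e) x := by
        intro x
        have h := (hconn.2 (G.src e) x).eq_of_forall_edge
          (f := fun x => (G.removeInterior e).Joined (G.src e) x ∨
            (G.removeInterior e).Joined (G.tgt e) x) fun e' => by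
          by_cases he' : e' = e
          · subst he'
            exact propext ⟨fun _ => Or.inr (.refl _), fun _ => Or.inl (.refl _)⟩
          · have hj : (G.removeInterior e).Joined (G.src e') (G.tgt e') :=
              joined_src_tgt (G := G.removeInterior e) ⟨e', he'⟩
            exact propext ⟨Or.imp (fun h => .trans _ _ _ h hj) (fun h => .trans _ _ _ h hj),
              Or.imp (fun h => .trans _ _ _ h (.symm _ _ hj))
                (fun h => .trans _ _ _ h (.symm _ _ hj))⟩
        exact h.mp (Or.inl (.refl _))
      rcases l.eq_empty_or_nonempty with rfl | ⟨v, hv⟩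
      · obtain ⟨v⟩ := hconn.1
        exact ⟨v, Set.empty_subset _⟩
      · refine ⟨v, fun w hw => ?_⟩
        have hvw : f v = f w := (hfl v hv).trans (hfl w hw).symm
        rcases hends v with h1 | h1 <;> rcases hends w with h2 | h2
        · exact .trans _ _ _ (.symm _ _ h1) h2
        · exact absurd (((hconst hf h2).trans hvw.symm).trans (hconst hf h1).symm) hne
        · exact absurd (((hconst hf h1).trans hvw).trans (hconst hf h2).symm) hne
        · exact .trans _ _ _ (.symm _ _ h1) h2
    · refine (mem_nonTrees_iff l _).2 ⟨by simp, fun htop => ?_⟩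
      rw [compl_compl, Set.image_singleton, he, Submodule.span_zero_singleton] at htop
      have := (Submodule.subsingleton_iff (ZMod 2)).1 (subsingleton_of_bot_eq_top htop)
      exact hpos.ne' Module.finrank_zero_of_subsingleton

theorem span_range_edgeClass [Finite E] (l : Set V) :
    Submodule.span (ZMod 2) (G.edgeClass l '' Set.univ) = ⊤ :=
  (span_edgeClass_eq_top_iff l Set.univ).2 fun _ => ⟨0, by simp⟩

end CWGraph

/-! ### The homotopy type of the order complex of a geometric lattice -/

section GeometricLatticeHomotopy

open Finset

/-- The chains removed from the interval have `d + 1` elements, hence are maximal simplices of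
dimension `d`. Each contributes one sphere, and there is at least one. -/
theorem IsGeometricRank.exists_homotopyEquiv_wedgeOfSpheres {L : Type*} [SemilatticeSup L]
    [OrderBot L] [Fintype L] {rk : L → ℕ} (h : IsGeometricRank rk) {d : ℕ} {W : L}
    (hW : rk W = d + 2) : ∃ m, 0 < m ∧ Nonempty
      (ContinuousMap.HomotopyEquiv (Realization (chainsIn (Set.Ioo ⊥ W))) (WedgeOfSpheres m d)) := by
  classical
  obtain ⟨Φ, hne, hsub, hcard, hcoll⟩ := h.exists_collapsible_sdiff (d + 1) W hW
  have hmax : ∀ φ ∈ Φ, ∀ τ ∈ chainsIn (Set.Ioo ⊥ W), φ ⊆ τ → τ = φ := fun φ hφ τ hτ hle =>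
    (eq_of_subset_of_card_le hle
      ((h.card_le_of_mem_chainsIn_Ioo hW hτ).trans_eq (hcard φ hφ).symm)).symm
  let ε : Fin (Nat.card Φ) ≃ Φ := (Finite.equivFin Φ).symm
  have henum : ∀ i, ∃ σ : Fin (d + 1) → L, Function.Injective σ ∧ univ.image σ = (ε i).1 := by
    intro i
    let η := (ε i).1.equivFinOfCardEq (hcard _ (ε i).2)
    refine ⟨fun j => (η.symm j).1, Subtype.val_injective.comp η.symm.injective, ?_⟩
    ext w
    simp only [mem_image, mem_univ, true_and]
    constructor
    · rintro ⟨j, rfl⟩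
      exact (η.symm j).2
    · exact fun hw => ⟨η ⟨w, hw⟩, by simp⟩
  choose σ hσ himage using henum
  have hK : {τ ∈ chainsIn (Set.Ioo ⊥ W) | ∀ i, τ ≠ univ.image (σ i)} =
      chainsIn (Set.Ioo ⊥ W) \ Φ := by
    ext τ
    simp only [Set.mem_ofPred_eq, Set.mem_sdiff, himage]
    refine and_congr_right fun _ => ⟨fun hτ hmem => hτ (ε.symm ⟨τ, hmem⟩)
      (by rw [Equiv.apply_symm_apply]), ?_⟩
    rintro hτ i rfl
    exact hτ (ε i).2
  have hlower : IsLowerSet (chainsIn (Set.Ioo ⊥ W) \ Φ) := by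
    intro τ τ' hle hτ
    refine ⟨isLowerSet_chainsIn _ hle hτ.1, fun hmem => hτ.2 ?_⟩
    rwa [hmax τ' hmem τ hτ.1 hle]
  have hcontr : ContractibleSpace
      (Realization {τ ∈ chainsIn (Set.Ioo ⊥ W) | ∀ i, τ ≠ univ.image (σ i)}) := by
    rw [hK]
    refine hcoll.contractibleSpace hlower ⟨∅, by simp [chainsIn], fun hmem => ?_⟩
    have := hcard ∅ hmem
    simp at this
  refine ⟨Nat.card Φ, Nat.card_pos_iff.2 ⟨hne.to_subtype, inferInstance⟩,
    Realization.nonempty_homotopyEquiv_wedgeOfSpheres (isLowerSet_chainsIn _) hσ ?_ ?_ ?_⟩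
  · intro i
    rw [himage]
    exact hsub (ε i).2
  · intro i τ hτ hle
    rw [himage] at hle ⊢
    exact hmax _ (ε i).2 τ hτ hle
  · intro i j hij
    simp only [himage] at hij
    exact ε.injective (Subtype.ext hij)

theorem WedgeOfSpheres.not_contractibleSpace {m d : ℕ} (hm : 0 < m) :
    ¬ ContractibleSpace (WedgeOfSpheres m d) := fun _ =>
  not_contractibleSpace_stdSphere d (contractibleSpace_stdSphere ⟨0, hm⟩)

end GeometricLatticeHomotopy

/-! ### Non-spanning sets of vectors -/

section NonSpanning

open Finset

variable {F Q E : Type*} [Field F] [AddCommGroup Q] [Module F Q] [Module.Finite F Q]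

/-- The lattice of subspaces spanned by some of the vectors of a family. -/
def SpanLattice (F : Type*) {Q E : Type*} [Field F] [AddCommGroup Q] [Module F Q] (u : E → Q) :
    Type _ :=
  {W : Submodule F Q // ∃ T : Set E, W = Submodule.span F (u '' T)}

namespace SpanLattice

variable {u : E → Q}

instance [Finite E] : Finite (SpanLattice F u) := by
  refine Finite.of_surjective
    (fun T : Set E => (⟨Submodule.span F (u '' T), T, rfl⟩ : SpanLattice F u)) ?_
  rintro ⟨_, T, rfl⟩
  exact ⟨T, rfl⟩

instance : SemilatticeSup (SpanLattice F u) :=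
  Subtype.semilatticeSup (by
    rintro _ _ ⟨T, rfl⟩ ⟨T', rfl⟩
    exact ⟨T ∪ T', by rw [Set.image_union, Submodule.span_union]⟩)

instance : OrderBot (SpanLattice F u) where
  bot := ⟨⊥, ∅, by simp⟩
  bot_le W := (bot_le : ⊥ ≤ W.1)

/-- The bound for joins with atoms is the dimension formula. If `x < y`, some spanning vector of `y`
lies outside `x`, and its line is the required atom. -/
theorem isGeometricRank : IsGeometricRank fun W : SpanLattice F u => Module.finrank F W.1 where
  strictMono := fun W W' h => Submodule.finrank_lt_finrank_of_lt (s := W.1) (t := W'.1) h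
  bot := finrank_bot F Q
  sup_atom_le := fun x a ha => by
    have h := Submodule.finrank_sup_add_finrank_inf_eq x.1 a.1
    change Module.finrank F (x.1 ⊔ a.1 : Submodule F Q) ≤ _
    omega
  exists_atom := by
    rintro x ⟨_, T, rfl⟩ h
    have hnot : ¬ Submodule.span F (u '' T) ≤ x.1 := fun hle =>
      absurd (lt_of_lt_of_le (a := x.1) h hle) (lt_irrefl _)
    rw [Submodule.span_le, Set.image_subset_iff, Set.not_subset] at hnot
    obtain ⟨e, heT, hex⟩ := hnot
    have hmem : u e ∉ x.1 := hex
    refine ⟨⟨Submodule.span F (u '' {e}), {e}, rfl⟩, ?_, ?_, ?_⟩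
    · change Module.finrank F (Submodule.span F (u '' {e})) = 1
      rw [Set.image_singleton]
      exact finrank_span_singleton fun h0 => hmem (h0 ▸ x.1.zero_mem)
    · exact Submodule.span_mono (Set.image_mono (Set.singleton_subset_iff.2 heT))
    · intro hle
      exact hmem (hle (Submodule.subset_span ⟨e, rfl, rfl⟩))

/-- The members of the family that lie in a given subspace. -/
def carrier (W : SpanLattice F u) : Set E := {e | u e ∈ W.1}

omit [Module.Finite F Q] in
theorem span_carrier (W : SpanLattice F u) : Submodule.span F (u '' W.carrier) = W.1 := by
  obtain ⟨_, T, rfl⟩ := W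
  refine le_antisymm (Submodule.span_le.2 ?_) (Submodule.span_mono (Set.image_mono ?_))
  · rintro _ ⟨e, he, rfl⟩
    exact he
  · exact fun e he => Submodule.subset_span ⟨e, he, rfl⟩

omit [Module.Finite F Q] in
theorem carrier_le_carrier {W W' : SpanLattice F u} : W.carrier ≤ W'.carrier ↔ W ≤ W' := by
  constructor
  · intro h
    change W.1 ≤ W'.1
    rw [← span_carrier W, ← span_carrier W']
    exact Submodule.span_mono (Set.image_mono h)
  · exact fun h e he => h he

omit [Module.Finite F Q] in
theorem carrier_injective :
    Function.Injective (carrier : SpanLattice F u → Set E) := fun _ _ h =>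
  le_antisymm (carrier_le_carrier.1 h.le) (carrier_le_carrier.1 h.ge)

end SpanLattice

/-- The nonempty sets of members of a family that do not span. -/
def nonSpanning (F : Type*) {Q E : Type*} [Field F] [AddCommGroup Q] [Module F Q] (u : E → Q) :
    Set (Set E) :=
  {T | T.Nonempty ∧ Submodule.span F (u '' T) ≠ ⊤}

variable [Finite E] {u : E → Q}

omit [Module.Finite F Q] in
-- Adding `e` does not change the span, and `{e}` does not span a nontrivial space. So the poset
-- retracts onto the sets containing `e`, a cone with apex `{e}`.
theorem contractibleSpace_nonSpanning [Fintype (Set E)] {e : E} (he : u e = 0)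
    (hQ : Nontrivial Q) : ContractibleSpace (Realization (chainsIn (nonSpanning F u))) := by
  classical
  have hmem : {e} ∈ nonSpanning F u := by
    refine ⟨Set.singleton_nonempty e, ?_⟩
    rw [Set.image_singleton, he, Submodule.span_zero_singleton]
    exact bot_ne_top
  refine ((collapsesTo_chainsIn_closed (Q := nonSpanning F u) (c := fun T => insert e T) ?_ ?_ ?_
    ?_).collapsible (collapsible_of_isDominated_empty (v := {e}) ?_)).contractibleSpace
      (isLowerSet_chainsIn _) (chainsIn_nonempty _)
  · rintro T ⟨h1, h2⟩
    refine ⟨Set.insert_nonempty _ _, ?_⟩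
    rwa [Set.image_insert_eq, he, Submodule.span_insert_zero]
  · exact fun T _ => Set.subset_insert e T
  · exact fun T _ T' _ h => Set.insert_subset_insert h
  · exact fun T _ => Set.insert_eq_of_mem (Set.mem_insert e T)
  · refine isDominated_chainsIn_empty ⟨hmem, by simp⟩ ?_
    rintro T ⟨_, hT⟩
    right
    change {e} ⊆ T
    rw [← hT]
    exact Set.singleton_subset_iff.2 (Set.mem_insert e T)

omit [Module.Finite F Q] in
-- The closure of `T` consists of all members of the family in the span of `T`. Closed sets
-- correspond to spanned subspaces, proper because `T` does not span, and nonzero because `T` is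
-- nonempty and no vector is zero.
theorem nonempty_homotopyEquiv_spanLattice [Fintype (Set E)] [Fintype (SpanLattice F u)]
    (hu : ∀ e, u e ≠ 0) (W : SpanLattice F u) (hW : W.1 = ⊤) :
    Nonempty (ContinuousMap.HomotopyEquiv (Realization (chainsIn (nonSpanning F u)))
      (Realization (chainsIn (Set.Ioo ⊥ W)))) := by
  classical
  have hspan : ∀ T : Set E, Submodule.span F (u '' {e | u e ∈ Submodule.span F (u '' T)}) =
      Submodule.span F (u '' T) := fun T =>
    SpanLattice.span_carrier (⟨Submodule.span F (u '' T), T, rfl⟩ : SpanLattice F u)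
  have hsub : ∀ T : Set E, T ⊆ {e | u e ∈ Submodule.span F (u '' T)} := fun T e he =>
    Submodule.subset_span ⟨e, he, rfl⟩
  obtain ⟨ε₁⟩ := (collapsesTo_chainsIn_closed (Q := nonSpanning F u)
    (c := fun T => {e | u e ∈ Submodule.span F (u '' T)})
    (fun T hT => ⟨hT.1.mono (hsub T), by rw [hspan]; exact hT.2⟩) (fun T _ => hsub T)
    (fun T _ T' _ h e he => Submodule.span_mono (Set.image_mono h) he)
    (fun T _ => by simp only [hspan])).nonempty_homotopyEquiv (isLowerSet_chainsIn _)
  have hrange : ∀ T : Set E, T ∈ {T ∈ nonSpanning F u |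
      {e | u e ∈ Submodule.span F (u '' T)} = T} ↔
        ∃ W' ∈ Set.Ioo ⊥ W, SpanLattice.carrier W' = T := by
    intro T
    constructor
    · rintro ⟨⟨⟨e, he⟩, h2⟩, h3⟩
      refine ⟨⟨Submodule.span F (u '' T), T, rfl⟩, ⟨?_, ?_⟩, h3⟩
      · refine bot_lt_iff_ne_bot.2 fun h => hu e ?_
        have h4 : Submodule.span F (u '' T) = ⊥ := congrArg Subtype.val h
        exact (Submodule.mem_bot F).1 (h4 ▸ Submodule.subset_span ⟨e, he, rfl⟩)
      · refine lt_of_le_of_ne (show Submodule.span F (u '' T) ≤ W.1 by rw [hW]; exact le_top) ?_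
        rintro rfl
        exact h2 hW
    · rintro ⟨W', ⟨h1, h2⟩, rfl⟩
      refine ⟨⟨?_, ?_⟩, ?_⟩
      · by_contra hempty
        rw [Set.not_nonempty_iff_eq_empty] at hempty
        have h3 := W'.span_carrier
        rw [hempty, Set.image_empty, Submodule.span_empty] at h3
        exact h1.ne (Subtype.ext h3)
      · rw [SpanLattice.span_carrier]
        intro h3
        exact h2.ne (Subtype.ext (h3.trans hW.symm))
      · rw [SpanLattice.span_carrier]
        rfl
  obtain ⟨ε₂⟩ := Realization.nonempty_homeomorph_of_injective
    (SpanLattice.carrier_injective (F := F) (u := u))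
    (K := chainsIn (Set.Ioo ⊥ W)) (L := chainsIn {T ∈ nonSpanning F u |
      {e | u e ∈ Submodule.span F (u '' T)} = T}) (fun σ => by
      constructor
      · rintro ⟨h1, h2⟩
        refine ⟨fun x hx => ?_, fun x hx y hy hxy => ?_⟩
        · obtain ⟨W', hW', heq⟩ := (hrange _).1 (h1 (mem_coe.2 (mem_map_of_mem _ hx)))
          rwa [← SpanLattice.carrier_injective heq]
        · exact (h2 (mem_coe.2 (mem_map_of_mem _ hx)) (mem_coe.2 (mem_map_of_mem _ hy))
            (SpanLattice.carrier_injective.ne hxy)).imp SpanLattice.carrier_le_carrier.1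
              SpanLattice.carrier_le_carrier.1
      · rintro ⟨h1, h2⟩
        refine ⟨?_, ?_⟩
        · intro T hT
          obtain ⟨x, hx, rfl⟩ := mem_map.1 (mem_coe.1 hT)
          exact (hrange _).2 ⟨x, h1 hx, rfl⟩
        · intro T hT T' hT' _
          obtain ⟨x, hx, rfl⟩ := mem_map.1 (mem_coe.1 hT)
          obtain ⟨y, hy, rfl⟩ := mem_map.1 (mem_coe.1 hT')
          exact (h2.total hx hy).imp SpanLattice.carrier_le_carrier.2
            SpanLattice.carrier_le_carrier.2)
    (fun τ hτ T hT => by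
      obtain ⟨W', _, h⟩ := (hrange T).1 (hτ.1 hT)
      exact ⟨W', h⟩)
  exact ⟨ε₁.trans ε₂.symm.toHomotopyEquiv⟩

end NonSpanning

/-! ### Order complexes as realisations -/

section OrderComplex

open Finset

/-- Reversing the order does not change which sets are chains. -/
theorem OrderComplex.nonempty_homeomorph_realization {P W : Type*} [PartialOrder P] [Finite P]
    [PartialOrder W] [Fintype W] {f : P → W} (hf : Function.Injective f)
    (hle : ∀ p q, f p ≤ f q ↔ q ≤ p) :
    Nonempty (OrderComplex P ≃ₜ Realization (chainsIn (Set.range f))) := by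
  classical
  have := Fintype.ofFinite P
  have hsupp : ∀ t : P → ℝ, ((coordSupport t : Finset P) : Set P) = {p | t p ≠ 0} := by
    intro t
    ext p
    simp
  let ε₁ : OrderComplex P ≃ₜ Realization {σ : Finset P | IsChain (· ≤ ·) (σ : Set P)} :=
    { toFun := fun t => ⟨t.1, t.2.1, (finsum_eq_sum_of_fintype _).symm.trans t.2.2.1, by
        rw [Set.mem_ofPred_eq, hsupp]; exact t.2.2.2⟩
      invFun := fun t => ⟨t.1, t.2.1, (finsum_eq_sum_of_fintype _).trans t.2.2.1, by
        rw [← hsupp]; exact t.2.2.2⟩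
      left_inv := fun t => rfl
      right_inv := fun t => rfl
      continuous_toFun := continuous_subtype_val.subtype_mk _
      continuous_invFun := Realization.continuous_val.subtype_mk _ }
  obtain ⟨ε₂⟩ := Realization.nonempty_homeomorph_of_injective hf
    (K := {σ : Finset P | IsChain (· ≤ ·) (σ : Set P)}) (L := chainsIn (Set.range f)) (fun σ => by
      constructor
      · rintro ⟨_, h⟩ x hx y hy hxy
        exact (h (mem_coe.2 (mem_map_of_mem _ hx)) (mem_coe.2 (mem_map_of_mem _ hy))
          (hf.ne hxy)).symm.imp (hle _ _).1 (hle _ _).1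
      · intro h
        refine ⟨?_, ?_⟩
        · intro w hw
          obtain ⟨x, -, rfl⟩ := mem_map.1 (mem_coe.1 hw)
          exact ⟨x, rfl⟩
        · intro w hw w' hw' _
          obtain ⟨x, hx, rfl⟩ := mem_map.1 (mem_coe.1 hw)
          obtain ⟨y, hy, rfl⟩ := mem_map.1 (mem_coe.1 hw')
          exact (IsChain.total h hx hy).symm.imp (hle _ _).2 (hle _ _).2)
    fun τ hτ w hw => hτ.1 hw
  exact ⟨ε₁.trans ε₂⟩

end OrderComplex

/-! ### The homotopy type of the poset of subgraphs -/

theorem isHomotopyWedge_of_contractibleSpace (d : ℤ) {X : Type*} [TopologicalSpace X]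
    [ContractibleSpace X] : IsHomotopyWedge d X := by
  unfold IsHomotopyWedge
  split_ifs
  · exact Or.inr ‹_›
  · exact ⟨0, ⟨(ContractibleSpace.hequiv X (WedgeOfSpheres 0 d.toNat)).some⟩⟩

/-- The homotopy type of the poset of non-spanning sets of a family of vectors. -/
theorem homotopyType_nonSpanning {F Q E : Type*} [Field F] [AddCommGroup Q] [Module F Q]
    [Module.Finite F Q] [Finite E] [Fintype (Set E)] {u : E → Q}
    (hspan : Submodule.span F (u '' Set.univ) = ⊤) {X : Type*} [TopologicalSpace X]
    (ε : X ≃ₜ Realization (chainsIn (nonSpanning F u))) :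
    IsHomotopyWedge ((Module.finrank F Q : ℤ) - 2) X ∧
      (ContractibleSpace X ↔ ∃ e, u e = 0 ∧ 0 < Module.finrank F Q) := by
  classical
  by_cases hloop : ∃ e, u e = 0 ∧ 0 < Module.finrank F Q
  · obtain ⟨e, he, hpos⟩ := hloop
    have := contractibleSpace_nonSpanning (F := F) he (Module.finrank_pos_iff.1 hpos)
    have : ContractibleSpace X := ε.contractibleSpace
    exact ⟨isHomotopyWedge_of_contractibleSpace _, fun _ => ⟨e, he, hpos⟩, fun _ => this⟩
  · have hempty : IsEmpty X → ¬ ContractibleSpace X := fun h _ =>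
      h.elim (Classical.choice (inferInstance : Nonempty X))
    rcases Nat.eq_zero_or_pos (Module.finrank F Q) with h0 | hpos
    · have hQ : Subsingleton Q := Module.finrank_zero_iff.1 h0
      have hne : nonSpanning F u = ∅ := by
        ext T
        simp only [Set.mem_empty_iff_false, iff_false]
        exact fun h => h.2 (Subsingleton.elim _ _)
      have : IsEmpty (Realization (chainsIn (nonSpanning F u))) := by
        refine Realization.isEmpty_of_subset_singleton_empty fun τ hτ => ?_
        rw [hne] at hτ
        simpa using Set.subset_empty_iff.1 hτ.1
      have hX : IsEmpty X := ε.toEquiv.isEmpty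
      refine ⟨?_, iff_of_false (hempty hX) hloop⟩
      rw [h0]
      exact if_pos (by norm_num) |>.mpr (Or.inl hX)
    · have hu : ∀ e, u e ≠ 0 := fun e he => hloop ⟨e, he, hpos⟩
      have := Fintype.ofFinite (SpanLattice F u)
      let W : SpanLattice F u := ⟨⊤, Set.univ, hspan.symm⟩
      have hW : Module.finrank F W.1 = Module.finrank F Q := finrank_top F Q
      obtain ⟨η⟩ := nonempty_homotopyEquiv_spanLattice hu W rfl
      have η' := ε.toHomotopyEquiv.trans η
      rcases Nat.lt_or_ge (Module.finrank F Q) 2 with hlt | hge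
      -- In dimension one there is no proper nonzero subspace, and the space is the empty wedge of
      -- `(-1)`-spheres.
      · have : IsEmpty (Realization (chainsIn (Set.Ioo ⊥ W))) := by
          refine Realization.isEmpty_of_subset_singleton_empty fun τ hτ => ?_
          have h1 := SpanLattice.isGeometricRank.card_le_of_mem_chainsIn_Ioo (n := 0)
            (show Module.finrank F W.1 = 0 + 1 by omega) hτ
          simpa using h1
        have hX : IsEmpty X := ⟨fun x => this.elim (η'.toFun x)⟩
        refine ⟨?_, iff_of_false (hempty hX) hloop⟩
        have hd : (Module.finrank F Q : ℤ) - 2 < 0 := by omega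
        unfold IsHomotopyWedge
        rw [if_pos hd]
        exact Or.inl hX
      · obtain ⟨d, hd⟩ := Nat.exists_eq_add_of_le' hge
        obtain ⟨m, hm, ⟨θ⟩⟩ := SpanLattice.isGeometricRank.exists_homotopyEquiv_wedgeOfSpheres
          (show Module.finrank F W.1 = d + 2 by omega)
        have ζ := η'.trans θ
        constructor
        · have hd' : (Module.finrank F Q : ℤ) - 2 = d := by omega
          unfold IsHomotopyWedge
          rw [hd', if_neg (by omega), Int.toNat_natCast]
          exact ⟨m, ⟨ζ⟩⟩
        · refine iff_of_false (fun _ => ?_) hloop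
          exact WedgeOfSpheres.not_contractibleSpace hm ζ.symm.contractibleSpace

theorem mainTheorem4 {V : Type*} {E : Type*} [Finite V] [Finite E]
    (G : CWGraph V E) (hiso : G.NoIsolatedVertices) (hconn : G.IsConnected)
    (l : Set V) (n k : ℕ) (hn : G.HasRank n) (hk : l.ncard = k) :
    IsHomotopyWedge (if 1 ≤ k then (n : ℤ) + (k : ℤ) - 3 else (n : ℤ) - 2)
        (OrderComplex (G.nonTrees l)) ∧
      (ContractibleSpace (OrderComplex (G.nonTrees l)) ↔ ∃ e : E, G.IsLSeparating l e) := by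
  classical
  have := Fintype.ofFinite (Set E)
  have := Fintype.ofFinite E
  -- Complementation identifies subgraphs in `X(G, l)` with nonempty non-spanning sets of edges,
  -- reversing the order.
  obtain ⟨ε⟩ := OrderComplex.nonempty_homeomorph_realization
    (f := fun S : G.nonTrees l => S.1ᶜ) (compl_injective.comp Subtype.val_injective)
    fun S S' => Set.compl_subset_compl
  have hrange : Set.range (fun S : G.nonTrees l => S.1ᶜ) =
      nonSpanning (ZMod 2) (G.edgeClass l) := by
    ext T
    constructor
    · rintro ⟨S, rfl⟩
      exact (CWGraph.mem_nonTrees_iff l S.1).1 S.2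
    · intro hT
      refine ⟨⟨Tᶜ, (CWGraph.mem_nonTrees_iff l _).2 ?_⟩, compl_compl T⟩
      rwa [compl_compl]
  rw [hrange] at ε
  obtain ⟨h1, h2⟩ := homotopyType_nonSpanning (CWGraph.span_range_edgeClass l) ε
  constructor
  · convert h1 using 1
    rw [CWGraph.finrank_relCohomology hconn hn l, hk]
    split_ifs <;> omega
  · rw [h2]
    exact exists_congr fun e => (CWGraph.isLSeparating_iff hconn l e).symm
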